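/- **Setting.** Work in coordinates $(u,r,\theta,\phi)$ with $r>0$, $0<\theta<\pi$, signature $(+,-,-,-)$, with real constants $\Lambda^*$, $a$ and $e\neq 0$. Put $R=r+ia\cos\theta$, $R^2:=R\bar R=r^2+a^2\cos^2\theta$. For a mass $M\in\mathbb R$ and a charge function $e(r)$ the variable-charged Reissner–Nordström–de Sitter (RNdS) metric is $$ds^2=\Big(1-\tfrac{2M}{r}+\tfrac{e(r)^2}{r^2}-\tfrac{\Lambda^*r^2}{3}\Big)du^2+2\,du\,dr-r^2(d\theta^2+\sin^2\theta\,d\phi^2),$$ and the variable-charged Kerr–Newman–de Sitter (KNdS) metric, with $H=2Mr-e(r)^2+\Lambda^*r^4/3$ and $\Delta^*=r^2-2Mr+a^2+e(r)^2-\Lambda^*r^4/3$, is $$ds^2=(1-HR^{-2})du^2+2\,du\,dr+2aHR^{-2}\sin^2\theta\,du\,d\phi-2a\sin^2\theta\,dr\,d\phi-R^2d\theta^2-\{(r^2+a^2)^2-\Delta^*a^2\sin^2\theta\}R^{-2}\sin^2\theta\,d\phi^2 .$$ Use the null tetrad $\ell_a=(1,0,0,-a\sin^2\theta)$, $n_a=\big(\tfrac{\Delta^*}{2R^2},1,0,-\tfrac{\Delta^*}{2R^2}a\sin^2\theta\big)$,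 $m_a=-\tfrac{1}{\sqrt2R}\big(-ia\sin\theta,0,R^2,i(r^2+a^2)\sin\theta\big)$ (put $a=0$ for RNdS), with $\psi_2=-C_{abcd}\ell^am^b\bar m^cn^d$, $\phi_{11}=-\tfrac14R_{ab}(\ell^an^b+m^a\bar m^b)$, $\Lambda=\tfrac1{24}R_{ab}g^{ab}$ (Newman–Penrose conventions). Split $\Lambda=\Lambda^{(C)}+\Lambda^{(E)}$ and $\phi_{11}=\phi_{11}^{(C)}+\phi_{11}^{(E)}$ with the cosmological parts $\Lambda^{(C)}=\Lambda^*r^2/(6R^2)$ and $\phi_{11}^{(C)}=-\Lambda^*r^2a^2\cos^2\theta/(2R^4)$ (for RNdS: $\Lambda^*/6$ and $0$). The Maxwell scalar of charge $e$ is $\phi_1=e/(\sqrt2\,\bar R^2)$. An *electrical radiation* of a black hole of mass $M$ and charge $e$ replaces the constant $e$ by a non-constant $C^2$ function $e(r)$, $r>0$, such that the metric with $M$, $e(r)$ satisfies $\Lambda^{(E)}=0$ and $\phi_{11}^{(E)}=\phi_1\bar\phi_1$. An *evaporation process* is an infinite sequence of successive radiations; each starts from the mass left by the preceding one, and the spacetime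 it leaves is identified with the metric of the same family with the new mass and the constant charge $e$. A *naked singularity* at $r\to0$ is one at which a scalar polynomial curvature invariant ($R$, $R_{ab}R^{ab}$ or $R_{abcd}R^{abcd}$) diverges in absolute value along a future-directed null geodesic that starts there at a finite affine parameter and escapes to $r\to\infty$, and which is not hidden by a horizon: there are radii at which the hypersurface $r=\mathrm{const}$ is timelike, and whenever it is timelike for some radius it is timelike for all smaller radii. It is *instantaneous* in the process if the mass is zero at exactly the stage concerned, is positive at all earlier stages, and becomes and stays negative at all later ones. **Theorem 2.** For the RNdS family, and for the KNdS family with every $a\in\mathbb R$: 1. For every electrical radiation of a black hole of mass $M$ there is a constant $m>0$ with $e(r)^2=2rm+e^2$ for all $r>0$, and the metric becomes that of mass $M-m$ and constant charge $e$. Conversely, for every $M\in\mathbb R$ and all $m_1,m_2,\ldots>0$ there is an evaporation process from mass $M$ with these successive mass losses. In every evaporation process the mass after $n$ radiations is $\mathcal M=M-(m_1+\dots+m_n)$, where $m_k>0$ is the loss in the $k$-th radiation and its charge function satisfies $e_k(r)^2=2rm_k+e^2$. 2. When $m_1+\dots+m_n=M$, so that $\mathcal M=0$, the remaining spacetime is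 the charged de Sitter metric $$ds^2=\Big(1+\tfrac{e^2}{r^2}-\tfrac{\Lambda^*r^2}{3}\Big)du^2+2\,du\,dr-r^2(d\theta^2+\sin^2\theta\,d\phi^2)$$ in the non-rotating case, and the rotating charged de Sitter metric $$ds^2=\Big\{1+\Big(e^2-\tfrac{\Lambda^*r^4}{3}\Big)R^{-2}\Big\}du^2+2\,du\,dr-2aR^{-2}\Big(e^2-\tfrac{\Lambda^*r^4}{3}\Big)\sin^2\theta\,du\,d\phi-2a\sin^2\theta\,dr\,d\phi-R^2d\theta^2-\{(r^2+a^2)^2-\Delta^*a^2\sin^2\theta\}R^{-2}\sin^2\theta\,d\phi^2,$$ $\Delta^*=r^2+a^2+e^2-\Lambda^*r^4/3$, in the rotating case; and it is an instantaneous naked singularity of the process. 3. The tetrad above, with zero mass and constant charge $e$, is a null tetrad of these metrics: $g_{ab}=\ell_an_b+n_a\ell_b-m_a\bar m_b-\bar m_am_b$. Their Weyl scalar is, respectively, $$\psi_2=\frac{e^2}{r^4},\qquad \psi_2=\frac{1}{\bar R\,\bar R\,R^2}\Big\{e^2+\frac{\Lambda^*r^2}{3}a^2\cos^2\theta\Big\},$$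 so it depends only on $e$ and, in the rotating case, on $\Lambda^*$ coupled with $a$; the Ricci scalar is $\Lambda=\Lambda^{(C)}$ and $\phi_{11}^{(E)}=\phi_1\bar\phi_1$, i.e. the Maxwell scalar and the cosmological part are unaffected. -/

import Mathlib

open Set Filter Topology
open scoped ContDiff

noncomputable section

/-- Coordinate points `(u, r, θ, φ) = (x 0, x 1, x 2, x 3)`. -/
abbrev Pt := Fin 4 → ℝ

/-- A field of metric components, in signature `(+,-,-,-)`. -/
abbrev MetricField := Pt → Matrix (Fin 4) (Fin 4) ℝ

/-- The coordinate domain `r > 0`, `0 < θ < π`. -/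
def chart : Set Pt := {x | 0 < x 1 ∧ 0 < x 2 ∧ x 2 < Real.pi}

/-! ### Curvature of a metric field -/

/-- Partial derivative with respect to the `i`-th coordinate. -/
def pd (i : Fin 4) (f : Pt → ℝ) (x : Pt) : ℝ :=
  deriv (fun t => f (Function.update x i t)) (x i)

/-- Christoffel symbols `Γ^a_{bc}`. -/
def christoffel (g : MetricField) (a b c : Fin 4) (x : Pt) : ℝ :=
  (1 / 2) * ∑ d, (g x)⁻¹ a d *
    (pd b (fun y => g y d c) x + pd c (fun y => g y d b) x - pd d (fun y => g y b c) x)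

/-- Riemann tensor `R^a_{bcd}`. -/
def riemannUp (g : MetricField) (a b c d : Fin 4) (x : Pt) : ℝ :=
  pd c (christoffel g a b d) x - pd d (christoffel g a b c) x
    + ∑ e, (christoffel g a e c x * christoffel g e b d x
          - christoffel g a e d x * christoffel g e b c x)

/-- Riemann tensor `R_{abcd}`. -/
def riemann (g : MetricField) (a b c d : Fin 4) (x : Pt) : ℝ :=
  ∑ e, g x a e * riemannUp g e b c d x

/-- Ricci tensor in the Newman–Penrose sign convention, `R_{ab} = R^c_{abc}`; with it de Sitter
space satisfies `R_{ab} = Λ* g_{ab}` in signature `(+,-,-,-)`. -/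
def ricci (g : MetricField) (a b : Fin 4) (x : Pt) : ℝ :=
  ∑ c, riemannUp g c a b c x

/-- Ricci curvature scalar `R_{ab} g^{ab}`. -/
def scalarCurv (g : MetricField) (x : Pt) : ℝ :=
  ∑ a, ∑ b, (g x)⁻¹ a b * ricci g a b x

/-- Weyl tensor `C_{abcd}`, the trace-free part of `R_{abcd}` in dimension four. The signs of the
Ricci terms are those that belong to `R_{ab} = R^c_{abc}`. -/
def weyl (g : MetricField) (a b c d : Fin 4) (x : Pt) : ℝ :=
  riemann g a b c d x
    + (1 / 2) * (g x a c * ricci g b d x - g x a d * ricci g b c x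
                - g x b c * ricci g a d x + g x b d * ricci g a c x)
    - scalarCurv g x / 6 * (g x a c * g x b d - g x a d * g x b c)

/-- The invariant `R_{ab} R^{ab}`. -/
def ricciSq (g : MetricField) (x : Pt) : ℝ :=
  ∑ a, ∑ b, ∑ c, ∑ d, (g x)⁻¹ a c * (g x)⁻¹ b d * ricci g a b x * ricci g c d x

/-- The Kretschmann invariant `R_{abcd} R^{abcd}`. -/
def kretschmann (g : MetricField) (x : Pt) : ℝ :=
  ∑ a, ∑ b, ∑ c, ∑ d, ∑ p, ∑ q, ∑ s, ∑ t,
    (g x)⁻¹ a p * (g x)⁻¹ b q * (g x)⁻¹ c s * (g x)⁻¹ d t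
      * riemann g a b c d x * riemann g p q s t x

/-! ### Newman–Penrose scalars -/

/-- The covariant components of a null tetrad `ℓ, n, m, m̄` (with `ℓ, n` real). -/
structure NullTetrad where
  l : Pt → Fin 4 → ℝ
  n : Pt → Fin 4 → ℝ
  m : Pt → Fin 4 → ℂ

/-- The tetrad is a null tetrad of `g`:
`g_{ab} = ℓ_a n_b + n_a ℓ_b - m_a m̄_b - m̄_a m_b`. -/
def NullTetrad.IsNullTetradOf (T : NullTetrad) (g : MetricField) : Prop :=
  ∀ x ∈ chart, ∀ a b, (g x a b : ℂ) =
    T.l x a * T.n x b + T.n x a * T.l x b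
      - T.m x a * star (T.m x b) - star (T.m x a) * T.m x b

/-- Raising the index of a (complex) covector. -/
def raise (g : MetricField) (x : Pt) (w : Fin 4 → ℂ) (a : Fin 4) : ℂ :=
  ∑ b, ((g x)⁻¹ a b : ℂ) * w b

/-- `ψ₂ = - C_{abcd} ℓ^a m^b m̄^c n^d`. -/
def npPsi2 (g : MetricField) (T : NullTetrad) (x : Pt) : ℂ :=
  - ∑ a, ∑ b, ∑ c, ∑ d, (weyl g a b c d x : ℂ)
      * raise g x (fun i => (T.l x i : ℂ)) a * raise g x (T.m x) b
      * raise g x (fun i => star (T.m x i)) c * raise g x (fun i => (T.n x i : ℂ)) d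

/-- `φ₁₁ = - (1/4) R_{ab} (ℓ^a n^b + m^a m̄^b)`. -/
def npPhi11 (g : MetricField) (T : NullTetrad) (x : Pt) : ℂ :=
  - (1 / 4) * ∑ a, ∑ b, (ricci g a b x : ℂ)
      * (raise g x (fun i => (T.l x i : ℂ)) a * raise g x (fun i => (T.n x i : ℂ)) b
        + raise g x (T.m x) a * raise g x (fun i => star (T.m x i)) b)

/-- `Λ = (1/24) R_{ab} g^{ab}`. -/
def npLambda (g : MetricField) (x : Pt) : ℝ := scalarCurv g x / 24

/-! ### The variable-charged black holes in de Sitter space -/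

/-- Data attached to a family of charged black holes in de Sitter space with mass parameter `M`
and charge function `e(r)`: the metric, its null tetrad, the cosmological parts of the Ricci
scalars `Λ` and `φ₁₁`, and the Maxwell scalar `φ₁` of the field of a constant charge. -/
structure BlackHoleFamily where
  metric : ℝ → (ℝ → ℝ) → MetricField
  tetrad : ℝ → (ℝ → ℝ) → NullTetrad
  lambdaC : Pt → ℝ
  phi11C : Pt → ℝ
  maxwell : ℝ → Pt → ℂ

/-- The function `1 - 2M/r + e(r)²/r² - Λ* r²/3`. -/
def rnFun (L M : ℝ) (e : ℝ → ℝ) (r : ℝ) : ℝ :=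
  1 - 2 * M / r + e r ^ 2 / r ^ 2 - L * r ^ 2 / 3

/-- Variable-charged Reissner–Nordström–de Sitter black holes with cosmological constant `L`. -/
def rnDeSitter (L : ℝ) : BlackHoleFamily where
  metric M e x :=
    !![rnFun L M e (x 1), 1, 0, 0;
       1, 0, 0, 0;
       0, 0, -(x 1) ^ 2, 0;
       0, 0, 0, -(x 1) ^ 2 * Real.sin (x 2) ^ 2]
  tetrad M e :=
    { l := fun _ => ![1, 0, 0, 0]
      n := fun x => ![rnFun L M e (x 1) / 2, 1, 0, 0]
      m := fun x => ![0, 0, -((x 1 / √2 : ℝ) : ℂ),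
        -((x 1 / √2 : ℝ) : ℂ) * Complex.I * (Real.sin (x 2) : ℂ)] }
  lambdaC _ := L / 6
  phi11C _ := 0
  maxwell e x := ((e / (√2 * (x 1) ^ 2) : ℝ) : ℂ)

/-- `R² = r² + a² cos² θ`. -/
def Rsq (a : ℝ) (x : Pt) : ℝ := (x 1) ^ 2 + a ^ 2 * Real.cos (x 2) ^ 2

/-- `R = r + i a cos θ`. -/
def Rc (a : ℝ) (x : Pt) : ℂ := (x 1 : ℂ) + Complex.I * (a * Real.cos (x 2) : ℝ)

/-- `Δ* = r² - 2 M r + a² + e(r)² - Λ* r⁴ / 3`. -/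
def deltaStar (a L M : ℝ) (e : ℝ → ℝ) (r : ℝ) : ℝ :=
  r ^ 2 - 2 * M * r + a ^ 2 + e r ^ 2 - L * r ^ 4 / 3

/-- Variable-charged Kerr–Newman–de Sitter black holes with rotation parameter `a` and
cosmological constant `L`. -/
def knDeSitter (a L : ℝ) : BlackHoleFamily where
  metric M e x :=
    let r := x 1
    let s := Real.sin (x 2)
    let H := 2 * M * r - e r ^ 2 + L * r ^ 4 / 3
    !![1 - H / Rsq a x, 1, 0, a * H / Rsq a x * s ^ 2;
       1, 0, 0, -a * s ^ 2;
       0, 0, -Rsq a x, 0;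
       a * H / Rsq a x * s ^ 2, -a * s ^ 2, 0,
         -((r ^ 2 + a ^ 2) ^ 2 - deltaStar a L M e r * a ^ 2 * s ^ 2) / Rsq a x * s ^ 2]
  tetrad M e :=
    { l := fun x => ![1, 0, 0, -a * Real.sin (x 2) ^ 2]
      n := fun x => ![deltaStar a L M e (x 1) / (2 * Rsq a x), 1, 0,
        -(deltaStar a L M e (x 1) / (2 * Rsq a x)) * a * Real.sin (x 2) ^ 2]
      m := fun x i => -(1 / ((√2 : ℝ) * Rc a x)) *
        (![-(Complex.I * (a * Real.sin (x 2) : ℝ)), 0, (Rsq a x : ℂ),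
          Complex.I * (((x 1) ^ 2 + a ^ 2) * Real.sin (x 2) : ℝ)] : Fin 4 → ℂ) i }
  lambdaC x := L * (x 1) ^ 2 / (6 * Rsq a x)
  phi11C x := -(L * (x 1) ^ 2 * a ^ 2 * Real.cos (x 2) ^ 2) / (2 * Rsq a x ^ 2)
  maxwell e x := (e : ℂ) / ((√2 : ℝ) * star (Rc a x) ^ 2)

/-! ### The non-rotating and rotating charged de Sitter metrics -/

/-- `ds² = (1 + e²/r² - Λ* r²/3) du² + 2 du dr - r² (dθ² + sin² θ dφ²)`. -/
def chargedDeSitter (L e : ℝ) : MetricField := fun x =>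
  !![1 + e ^ 2 / (x 1) ^ 2 - L * (x 1) ^ 2 / 3, 1, 0, 0;
     1, 0, 0, 0;
     0, 0, -(x 1) ^ 2, 0;
     0, 0, 0, -(x 1) ^ 2 * Real.sin (x 2) ^ 2]

/-- `ds² = {1 + (e² - Λ* r⁴/3) R⁻²} du² + 2 du dr - 2 a R⁻² (e² - Λ* r⁴/3) sin² θ du dφ
- 2 a sin² θ dr dφ - R² dθ² - {(r² + a²)² - Δ* a² sin² θ} R⁻² sin² θ dφ²`, where
`Δ* = r² + a² + e² - Λ* r⁴/3`. -/
def rotatingChargedDeSitter (a L e : ℝ) : MetricField := fun x =>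
  let r := x 1
  let s := Real.sin (x 2)
  let K := e ^ 2 - L * r ^ 4 / 3
  let D := r ^ 2 + a ^ 2 + e ^ 2 - L * r ^ 4 / 3
  !![1 + K / Rsq a x, 1, 0, -a * K / Rsq a x * s ^ 2;
     1, 0, 0, -a * s ^ 2;
     0, 0, -Rsq a x, 0;
     -a * K / Rsq a x * s ^ 2, -a * s ^ 2, 0,
       -((r ^ 2 + a ^ 2) ^ 2 - D * a ^ 2 * s ^ 2) / Rsq a x * s ^ 2]

/-! ### Electrical radiation -/

/-- The Einstein–Maxwell conditions for mass `M` and charge function `ε(r)`, relative to a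
field with Maxwell scalar `φ₁` of charge `e`: after the cosmological parts have been split off,
`Λ^(E) = 0` and `φ₁₁^(E) = φ₁ φ̄₁`. -/
def HasElectromagneticField (F : BlackHoleFamily) (e M : ℝ) (ε : ℝ → ℝ) : Prop :=
  ∀ x ∈ chart,
    npLambda (F.metric M ε) x - F.lambdaC x = 0 ∧
    npPhi11 (F.metric M ε) (F.tetrad M ε) x - (F.phi11C x : ℂ)
      = F.maxwell e x * star (F.maxwell e x)

/-- One electrical radiation of the black hole of mass `M` and charge `e`: the charge becomes a
non-constant function `ε(r)`, subject to the Einstein–Maxwell conditions with unchanged Maxwell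
scalar and unchanged cosmological constant. -/
structure IsElectricalRadiation (F : BlackHoleFamily) (e M : ℝ) (ε : ℝ → ℝ) : Prop where
  smooth : ContDiffOn ℝ 2 ε (Ioi 0)
  variable_charge : ¬ ∃ c, ∀ r, 0 < r → ε r = c
  field : HasElectromagneticField F e M ε

/-- The evaporation process: successive electrical radiations `ε 0, ε 1, …`. The `k`-th one starts
from mass `mass k`, and the spacetime that it leaves is the one of mass `mass (k + 1)` and
constant charge `e`. -/
structure IsEvaporation (F : BlackHoleFamily) (e M : ℝ) (mass : ℕ → ℝ) (ε : ℕ → ℝ → ℝ) :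
    Prop where
  init : mass 0 = M
  radiates : ∀ k, IsElectricalRadiation F e (mass k) (ε k)
  leaves : ∀ k, ∀ x ∈ chart,
    F.metric (mass k) (ε k) x = F.metric (mass (k + 1)) (fun _ => e) x

/-! ### Naked singularities -/

/-- `γ`, with parameter in `(0, ∞)`, is an affinely parametrized null geodesic of `g` in the chart
that is future directed for the time orientation given by the timelike covector `τ`. -/
structure IsFutureNullGeodesic (g : MetricField) (τ : Pt → Fin 4 → ℝ) (γ : ℝ → Pt) : Prop where
  smooth : ContDiffOn ℝ 2 γ (Ioi 0)
  mem_chart : ∀ s, 0 < s → γ s ∈ chart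
  null : ∀ s, 0 < s → ∑ a, ∑ b, g (γ s) a b * deriv γ s a * deriv γ s b = 0
  future : ∀ s, 0 < s → 0 < ∑ a, τ (γ s) a * deriv γ s a
  geodesic : ∀ s, 0 < s → ∀ a, deriv (deriv γ) s a
    + ∑ b, ∑ c, christoffel g a b c (γ s) * deriv γ s b * deriv γ s c = 0

/-- A scalar polynomial curvature invariant diverges along `γ` as the parameter tends to `0`. -/
def CurvatureBlowsUp (g : MetricField) (γ : ℝ → Pt) : Prop :=
  Tendsto (fun s => |scalarCurv g (γ s)|) (𝓝[>] 0) atTop ∨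
  Tendsto (fun s => |ricciSq g (γ s)|) (𝓝[>] 0) atTop ∨
  Tendsto (fun s => |kretschmann g (γ s)|) (𝓝[>] 0) atTop

/-- The radii whose hypersurfaces `r = const` are timelike, i.e. have a spacelike normal
(`g^{rr} < 0` in signature `(+,-,-,-)`). At a horizon `r = const` the hypersurface is null. -/
def timelikeRadii (g : MetricField) : Set ℝ :=
  {r | 0 < r ∧ ∀ x ∈ chart, x 1 = r → (g x)⁻¹ 1 1 < 0}

/-- A naked singularity at `r → 0`.
* It is a curvature singularity which is visible: a future directed null geodesic comes out of it,
  at a finite value of the affine parameter, and escapes to arbitrarily large `r`.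
* It is not hidden by a horizon: no horizon lies between `r = 0` and a radius at which the
  hypersurface `r = const` is timelike. (The event horizon of a black hole does separate `r = 0`
  from such a region; the cosmological horizon of de Sitter space does not.) -/
structure IsNakedSingularity (g : MetricField) (τ : Pt → Fin 4 → ℝ) : Prop where
  visible : ∃ γ : ℝ → Pt, IsFutureNullGeodesic g τ γ ∧
    Tendsto (fun s => γ s 1) (𝓝[>] 0) (𝓝 0) ∧ CurvatureBlowsUp g γ ∧
    Tendsto (fun s => γ s 1) atTop atTop
  static_nonempty : (timelikeRadii g).Nonempty
  not_hidden : ∀ r ∈ timelikeRadii g, ∀ r', 0 < r' → r' < r → r' ∈ timelikeRadii g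

/-- The timelike covector `ℓ + n`, which gives the time orientation. -/
def NullTetrad.time (T : NullTetrad) : Pt → Fin 4 → ℝ := fun x a => T.l x a + T.n x a

/-- An instantaneous naked singularity in the evaporation process with masses `mass 0, mass 1, …`:
at stage `n` the spacetime is a naked singularity of zero mass; the mass is zero at this stage
only, being positive at all earlier stages, and the radiation, which continues, makes it negative
at all later ones. -/
structure IsInstantaneousNakedSingularity (g : MetricField) (τ : Pt → Fin 4 → ℝ)
    (mass : ℕ → ℝ) (n : ℕ) : Prop where
  naked : IsNakedSingularity g τ
  zero_mass : mass n = 0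
  before : ∀ k, k < n → 0 < mass k
  after : ∀ k, n < k → mass k < 0

end

/-! ### Curvature is local on the chart -/

/-! On the chart both families are Kerr–Schild metrics g₀ - (H/R²) ℓ⊗ℓ with g₀ flat, and mass and
charge enter only through H = 2Mr - e(r)² + Λ* r⁴/3. RNdS is the case a = 0, so everything is proved
once for `IsKerrNewmanForm`. In a frame adapted to ℓ the Riemann tensor has four coefficients A, B,
D, E, linear in H, H', H'' (`riemannOfJet_kerrSchild`, `riemann_kerrSchild`). The scalar curvature
is H''/R², and φ₁₁ = (rH' - H)/(2R⁴) - H''/(8R²). The term 2Mr drops out of both, and the r⁴ term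
gives exactly the cosmological parts. With q = e(r)² the field conditions thus become q'' = 0 and q
- rq' = e² (`IsKerrNewmanForm.field_iff`). Hence q = br + e². Since q ≥ 0 at large r, b ≥ 0; since
e(r) is not constant, b ≠ 0 (`exists_loss_of_radiation`). With b = 2m, the term -2mr in H is
absorbed by the mass term, so the metric is that of mass M - m and charge e (`metric_radiated`).
Conversely, e(r) = √(2rm + e²) is a radiation for every m > 0, and iteration gives the evaporation.
At zero mass, R_{ab}R^{ab} = 4Λ*² + 4e⁴/r⁸ along the equatorial principal null ray, which is a
geodesic for every H. The timelike radii are those with Δ* > 0, and Δ*(tr) ≥ t⁴Δ*(r) for 0 < t < 1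
makes them closed downwards (`isNakedSingularity_massless`). The mass is strictly decreasing, so the
singularity is instantaneous. -/

theorem eventually_update_mem_chart {x : Pt} (hx : x ∈ chart) (i : Fin 4) :
    ∀ᶠ t in 𝓝 (x i), Function.update x i t ∈ chart := by
  have hopen : IsOpen chart := by
    refine (isOpen_lt continuous_const (continuous_apply 1)).inter
      ((isOpen_lt continuous_const (continuous_apply 2)).inter
        (isOpen_lt (continuous_apply 2) continuous_const))
  have hc : Continuous fun t : ℝ => Function.update x i t :=
    continuous_const.update i continuous_id
  refine hc.continuousAt.eventually (hopen.mem_nhds ?_)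
  simpa using hx

/-- The chart is open, so a partial derivative at one of its points sees only values on the chart.
Curvature can therefore be transported along equalities that hold only there, where r and R² are
nonzero. -/
theorem pd_congr {f f' : Pt → ℝ} (h : EqOn f f' chart) (i : Fin 4) :
    EqOn (pd i f) (pd i f') chart := by
  intro x hx
  refine Filter.EventuallyEq.deriv_eq ?_
  filter_upwards [eventually_update_mem_chart hx i] with t ht using h ht

section Congr

variable {g g' : MetricField} (h : EqOn g g' chart)
include h

theorem christoffel_congr (a b c : Fin 4) :
    EqOn (christoffel g a b c) (christoffel g' a b c) chart := by
  have hp : ∀ i a b, EqOn (pd i fun y => g y a b) (pd i fun y => g' y a b) chart :=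
    fun i a b => pd_congr (fun y hy => by simp only [h hy]) i
  intro x hx
  simp only [christoffel, h hx, hp _ _ _ hx]

theorem riemannUp_congr (a b c d : Fin 4) :
    EqOn (riemannUp g a b c d) (riemannUp g' a b c d) chart := by
  intro x hx
  simp only [riemannUp, pd_congr (christoffel_congr h _ _ _) _ hx, christoffel_congr h _ _ _ hx]

theorem riemann_congr (a b c d : Fin 4) : EqOn (riemann g a b c d) (riemann g' a b c d) chart := by
  intro x hx
  simp only [riemann, riemannUp_congr h _ _ _ _ hx, h hx]

theorem ricci_congr (a b : Fin 4) : EqOn (ricci g a b) (ricci g' a b) chart := by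
  intro x hx
  simp only [ricci, riemannUp_congr h _ _ _ _ hx]

end Congr

/-! ### The Riemann tensor from the second-order jet of the metric -/

/-- Christoffel symbols `Γ_{abc}` with the first index lowered, from the first derivatives
`G i = ∂_i g` of the metric. -/
noncomputable def lowerChristoffel (G : Fin 4 → Matrix (Fin 4) (Fin 4) ℝ) (a b c : Fin 4) : ℝ :=
  1 / 2 * (G b a c + G c a b - G a b c)

/-- The Riemann tensor `R_{abcd}` from the inverse metric and the derivatives `G i = ∂_i g`,
`G' i j = ∂_i ∂_j g` of the metric. -/
noncomputable def riemannOfJet (gi : Matrix (Fin 4) (Fin 4) ℝ)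
    (G : Fin 4 → Matrix (Fin 4) (Fin 4) ℝ) (G' : Fin 4 → Fin 4 → Matrix (Fin 4) (Fin 4) ℝ)
    (a b c d : Fin 4) : ℝ :=
  lowerChristoffel (G' c) a b d - lowerChristoffel (G' d) a b c
    - ∑ e, ∑ f, gi e f * (lowerChristoffel G e a c * lowerChristoffel G f b d
        - lowerChristoffel G e a d * lowerChristoffel G f b c)

/-- `G` and `G'` are the first and second coordinate derivatives of the nondegenerate metric
field `g` on the chart. -/
structure HasMetricJet (g : MetricField) (G : Fin 4 → MetricField)
    (G' : Fin 4 → Fin 4 → MetricField) : Prop where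
  isUnit_det : ∀ x ∈ chart, IsUnit (g x).det
  symm : ∀ i x a b, G i x a b = G i x b a
  fst : ∀ x ∈ chart, ∀ i a b,
    HasDerivAt (fun t => g (Function.update x i t) a b) (G i x a b) (x i)
  snd : ∀ x ∈ chart, ∀ i j a b,
    HasDerivAt (fun t => G j (Function.update x i t) a b) (G' i j x a b) (x i)

/-- By Cramer's rule, the entries are polynomials in those of `A` divided by the determinant. The
value of the derivative is never needed. -/
theorem DifferentiableAt.matrix_inv_apply {A : ℝ → Matrix (Fin 4) (Fin 4) ℝ} {t : ℝ}
    (hA : ∀ a b, DifferentiableAt ℝ (fun s => A s a b) t) (hdet : IsUnit (A t).det)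
    (a b : Fin 4) : DifferentiableAt ℝ (fun s => (A s)⁻¹ a b) t := by
  have det_diff : ∀ B : ℝ → Matrix (Fin 4) (Fin 4) ℝ,
      (∀ a b, DifferentiableAt ℝ (fun s => B s a b) t) →
        DifferentiableAt ℝ (fun s => (B s).det) t := by
    intro B hB
    simp only [Matrix.det_apply]
    refine DifferentiableAt.fun_sum fun σ _ => DifferentiableAt.const_smul ?_ _
    exact DifferentiableAt.fun_finsetProd fun i _ => hB _ _
  simp only [Matrix.inv_def, Ring.inverse_eq_inv', Matrix.smul_apply, smul_eq_mul,
    Matrix.adjugate_apply]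
  refine ((det_diff A hA).inv hdet.ne_zero).mul (det_diff _ fun c d => ?_)
  by_cases hc : c = b
  · subst hc
    simp
  · simpa [Matrix.updateRow_ne hc] using hA c d

namespace HasMetricJet

variable {g : MetricField} {G : Fin 4 → MetricField} {G' : Fin 4 → Fin 4 → MetricField}
  (h : HasMetricJet g G G') {x : Pt}
include h

theorem pd_eq (hx : x ∈ chart) (i a b : Fin 4) : pd i (fun y => g y a b) x = G i x a b :=
  (h.fst x hx i a b).deriv

theorem christoffel_eq (hx : x ∈ chart) (a b c : Fin 4) :
    christoffel g a b c x = ∑ d, (g x)⁻¹ a d * lowerChristoffel (fun i => G i x) d b c := by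
  simp only [christoffel, h.pd_eq hx, lowerChristoffel, Finset.mul_sum]
  exact Finset.sum_congr rfl fun d _ => by ring

theorem sum_mul_christoffel (hx : x ∈ chart) (a b c : Fin 4) :
    ∑ e, g x a e * christoffel g e b c x = lowerChristoffel (fun i => G i x) a b c := by
  have hmul := Matrix.mul_nonsing_inv (g x) (h.isUnit_det x hx)
  have : (g x).mulVec ((g x)⁻¹.mulVec fun d => lowerChristoffel (fun i => G i x) d b c) =
      fun d => lowerChristoffel (fun i => G i x) d b c := by
    rw [Matrix.mulVec_mulVec, hmul, Matrix.one_mulVec]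
  simpa only [h.christoffel_eq hx, Matrix.mulVec, dotProduct] using congrFun this a

theorem hasDerivAt_lowerChristoffel (hx : x ∈ chart) (i a b c : Fin 4) :
    HasDerivAt (fun t => lowerChristoffel (fun j => G j (Function.update x i t)) a b c)
      (lowerChristoffel (fun j => G' i j x) a b c) (x i) :=
  (((h.snd x hx i b a c).add (h.snd x hx i c a b)).sub (h.snd x hx i a b c)).const_mul _

theorem differentiableAt_christoffel (hx : x ∈ chart) (i a b c : Fin 4) :
    DifferentiableAt ℝ (fun t => christoffel g a b c (Function.update x i t)) (x i) := by
  have heq : (fun t => christoffel g a b c (Function.update x i t)) =ᶠ[𝓝 (x i)] fun t =>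
      ∑ d, (g (Function.update x i t))⁻¹ a d *
        lowerChristoffel (fun j => G j (Function.update x i t)) d b c := by
    filter_upwards [eventually_update_mem_chart hx i] with t ht using h.christoffel_eq ht a b c
  refine DifferentiableAt.congr_of_eventuallyEq ?_ heq
  refine DifferentiableAt.fun_sum fun d _ => DifferentiableAt.mul ?_
    (h.hasDerivAt_lowerChristoffel hx i d b c).differentiableAt
  refine DifferentiableAt.matrix_inv_apply (fun a b => (h.fst x hx i a b).differentiableAt) ?_ a d
  simpa using h.isUnit_det x hx

/-- The product rule applied to g_{ae} Γ^e_{bc} = Γ_{abc}. It trades derivatives of Γ^e_{bc} for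
second derivatives of the metric, so the inverse metric is never differentiated explicitly. -/
theorem sum_mul_pd_christoffel (hx : x ∈ chart) (i a b c : Fin 4) :
    ∑ e, g x a e * pd i (christoffel g e b c) x = lowerChristoffel (fun j => G' i j x) a b c
      - ∑ e, G i x a e * christoffel g e b c x := by
  have hsum : HasDerivAt
      (fun t => ∑ e, g (Function.update x i t) a e * christoffel g e b c (Function.update x i t))
      (∑ e, (G i x a e * christoffel g e b c x + g x a e * pd i (christoffel g e b c) x))
      (x i) := by
    refine HasDerivAt.fun_sum fun e _ => ?_
    have := (h.fst x hx i a e).mul (h.differentiableAt_christoffel hx i e b c).hasDerivAt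
    simp only [Function.update_eq_self] at this
    exact this
  have heq : (fun t => ∑ e, g (Function.update x i t) a e *
      christoffel g e b c (Function.update x i t)) =ᶠ[𝓝 (x i)]
        fun t => lowerChristoffel (fun j => G j (Function.update x i t)) a b c := by
    filter_upwards [eventually_update_mem_chart hx i] with t ht using
      h.sum_mul_christoffel ht a b c
  have := (hsum.congr_of_eventuallyEq heq.symm).unique (h.hasDerivAt_lowerChristoffel hx i a b c)
  rw [Finset.sum_add_distrib] at this
  linarith

theorem riemann_eq (hx : x ∈ chart) (a b c d : Fin 4) :
    riemann g a b c d x = riemannOfJet (g x)⁻¹ (fun i => G i x) (fun i j => G' i j x) a b c d := by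
  -- Metric compatibility: ∂_c g_{af} = Γ_{afc} + Γ_{fac}. It merges the correction from the product
  -- rule with the quadratic terms.
  have hlow : ∀ f c, lowerChristoffel (fun i => G i x) a f c - G c x a f
      = - lowerChristoffel (fun i => G i x) f a c := by
    intro f c
    simp only [lowerChristoffel]
    linear_combination (1 / 2) * h.symm c x f a
  have hsum : ∀ c d, ∑ e, g x a e * ∑ f, christoffel g e f c x * christoffel g f b d x
      = ∑ f, lowerChristoffel (fun i => G i x) a f c * christoffel g f b d x := by
    intro c d
    simp only [← h.sum_mul_christoffel hx, Finset.mul_sum, Finset.sum_mul]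
    rw [Finset.sum_comm]
    exact Finset.sum_congr rfl fun f _ => Finset.sum_congr rfl fun e _ => by ring
  have hup : ∀ c d, ∑ f, lowerChristoffel (fun i => G i x) f a c * christoffel g f b d x
      = ∑ e, ∑ f, (g x)⁻¹ e f * (lowerChristoffel (fun i => G i x) e a c
          * lowerChristoffel (fun i => G i x) f b d) := by
    intro c d
    simp only [h.christoffel_eq hx, Finset.mul_sum]
    exact Finset.sum_congr rfl fun f _ => Finset.sum_congr rfl fun e _ => by ring
  have hneg : ∀ c d, ∑ f, lowerChristoffel (fun i => G i x) f a c * christoffel g f b d x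
      = ∑ e, G c x a e * christoffel g e b d x
        - ∑ f, lowerChristoffel (fun i => G i x) a f c * christoffel g f b d x := by
    intro c d
    rw [← Finset.sum_sub_distrib]
    refine Finset.sum_congr rfl fun f _ => ?_
    linear_combination christoffel g f b d x * hlow f c
  simp only [riemann, riemannUp, mul_add, mul_sub, Finset.sum_add_distrib, Finset.sum_sub_distrib,
    hsum, h.sum_mul_pd_christoffel hx, riemannOfJet, ← hup, hneg]
  ring

theorem riemannUp_eq (hx : x ∈ chart) (a b c d : Fin 4) :
    riemannUp g a b c d x = ∑ e, (g x)⁻¹ a e * riemann g e b c d x := by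
  have hmul := Matrix.nonsing_inv_mul (g x) (h.isUnit_det x hx)
  have : (g x)⁻¹.mulVec ((g x).mulVec fun e => riemannUp g e b c d x) = fun e => riemannUp g e b c d x := by
    rw [Matrix.mulVec_mulVec, hmul, Matrix.one_mulVec]
  simpa only [riemann, Matrix.mulVec, dotProduct] using (congrFun this a).symm

theorem ricci_eq (hx : x ∈ chart) (a b : Fin 4) :
    ricci g a b x = ∑ c, ∑ d, (g x)⁻¹ c d * riemann g d a b c x := by
  simp only [ricci, h.riemannUp_eq hx]

end HasMetricJet

/-! ### Symmetries -/

theorem riemannOfJet_swap_right (gi : Matrix (Fin 4) (Fin 4) ℝ)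
    (G : Fin 4 → Matrix (Fin 4) (Fin 4) ℝ) (G' : Fin 4 → Fin 4 → Matrix (Fin 4) (Fin 4) ℝ)
    (a b c d : Fin 4) : riemannOfJet gi G G' a b d c = - riemannOfJet gi G G' a b c d := by
  have : ∀ e f, gi e f * (lowerChristoffel G e a d * lowerChristoffel G f b c
        - lowerChristoffel G e a c * lowerChristoffel G f b d)
      = - (gi e f * (lowerChristoffel G e a c * lowerChristoffel G f b d
        - lowerChristoffel G e a d * lowerChristoffel G f b c)) := fun e f => by ring
  simp only [riemannOfJet, this, Finset.sum_neg_distrib]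
  ring

/-- The second-derivative terms match because mixed partials commute, the quadratic terms because
the inverse metric is symmetric. Together with `riemannOfJet_swap_right` this gives antisymmetry in
the first pair. -/
theorem riemannOfJet_pair_swap {gi : Matrix (Fin 4) (Fin 4) ℝ}
    {G : Fin 4 → Matrix (Fin 4) (Fin 4) ℝ} {G' : Fin 4 → Fin 4 → Matrix (Fin 4) (Fin 4) ℝ}
    (hgi : ∀ a b, gi a b = gi b a) (hG : ∀ i a b, G i a b = G i b a)
    (hG' : ∀ i j a b, G' i j a b = G' i j b a) (hG'' : ∀ i j a b, G' i j a b = G' j i a b)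
    (a b c d : Fin 4) : riemannOfJet gi G G' c d a b = riemannOfJet gi G G' a b c d := by
  have hlow : ∀ e a c, lowerChristoffel G e a c = lowerChristoffel G e c a := by
    intro e a c
    simp only [lowerChristoffel, hG e a c]
    ring
  have hsum : ∑ e, ∑ f, gi e f * (lowerChristoffel G e c a * lowerChristoffel G f d b
        - lowerChristoffel G e c b * lowerChristoffel G f d a)
      = ∑ e, ∑ f, gi e f * (lowerChristoffel G e a c * lowerChristoffel G f b d
        - lowerChristoffel G e a d * lowerChristoffel G f b c) := by
    simp only [mul_sub, Finset.sum_sub_distrib, hlow _ c a, hlow _ d b]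
    congr 1
    rw [Finset.sum_comm]
    refine Finset.sum_congr rfl fun f _ => Finset.sum_congr rfl fun e _ => ?_
    rw [hgi e f, hlow e c b, hlow f d a]
    ring
  simp only [riemannOfJet, hsum]
  simp only [lowerChristoffel, hG'' b c, hG'' b d, hG'' a d, hG'' a c, hG'' a b, hG'' d c]
  rw [hG' c a d b, hG' d a c b, hG' c b d a, hG' d b c a]
  ring

/-! ### The Kerr–Schild form of the metrics -/

/-- The shape of the metric components of a Kerr–Schild metric in the coordinates `(u, r, θ, φ)`
and of their derivatives. It is linear in `v`, which for the metric itself is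
`(1, F, sin² θ, F sin² θ, F sin⁴ θ, R², (r² + a²) sin² θ)`. -/
def ksMatrix (a : ℝ) (v : Fin 7 → ℝ) : Matrix (Fin 4) (Fin 4) ℝ :=
  !![v 0 - v 1, v 0, 0, a * v 3;
     v 0, 0, 0, -(a * v 2);
     0, 0, -v 5, 0;
     a * v 3, -(a * v 2), 0, -v 6 - a ^ 2 * v 4]

/-- The coefficients of the Kerr–Schild metric at a point with `sin θ = s`, `R² = ρ`. -/
def ksCoeff (a r s ρ F : ℝ) : Fin 7 → ℝ :=
  ![1, F, s ^ 2, F * s ^ 2, F * s ^ 4, ρ, (r ^ 2 + a ^ 2) * s ^ 2]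

/-- The first derivatives of `ksCoeff`. -/
def ksCoeffJet (a r s c F Fr Ft : ℝ) : Fin 4 → Fin 7 → ℝ :=
  ![0,
    ![0, Fr, 0, Fr * s ^ 2, Fr * s ^ 4, 2 * r, 2 * r * s ^ 2],
    ![0, Ft, 2 * s * c, Ft * s ^ 2 + 2 * F * s * c, Ft * s ^ 4 + 4 * F * s ^ 3 * c,
      -(2 * a ^ 2 * s * c), 2 * (r ^ 2 + a ^ 2) * s * c],
    0]

/-- The second derivatives of `ksCoeff`. -/
def ksCoeffJet' (a r s c F Fr Ft Frr Frt Ftt : ℝ) : Fin 4 → Fin 4 → Fin 7 → ℝ :=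
  let m : Fin 7 → ℝ := ![0, Frt, 0, Frt * s ^ 2 + 2 * Fr * s * c, Frt * s ^ 4 + 4 * Fr * s ^ 3 * c,
    0, 4 * r * s * c]
  ![0,
    ![0, ![0, Frr, 0, Frr * s ^ 2, Frr * s ^ 4, 2, 2 * s ^ 2], m, 0],
    ![0, m, ![0, Ftt, 2 * (c ^ 2 - s ^ 2),
      Ftt * s ^ 2 + 4 * Ft * s * c + 2 * F * (c ^ 2 - s ^ 2),
      Ftt * s ^ 4 + 8 * Ft * s ^ 3 * c + F * (12 * s ^ 2 * c ^ 2 - 4 * s ^ 4),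
      -(2 * a ^ 2 * (c ^ 2 - s ^ 2)), 2 * (r ^ 2 + a ^ 2) * (c ^ 2 - s ^ 2)], 0],
    0]

/-- The inverse of the Kerr–Schild metric, where `h = F ρ`. -/
noncomputable def ksInv (a r s ρ h : ℝ) : Matrix (Fin 4) (Fin 4) ℝ :=
  !![-(a ^ 2 * s ^ 2 / ρ), (r ^ 2 + a ^ 2) / ρ, 0, -(a / ρ);
     (r ^ 2 + a ^ 2) / ρ, -((r ^ 2 + a ^ 2 - h) / ρ), 0, a / ρ;
     0, 0, -(1 / ρ), 0;
     -(a / ρ), a / ρ, 0, -(1 / (ρ * s ^ 2))]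

/-- The Kerr–Schild metric `g₀ - (H / R²) ℓ ⊗ ℓ`, where `g₀` is flat. -/
noncomputable def kerrSchild (a : ℝ) (H : ℝ → ℝ) : MetricField := fun x =>
  ksMatrix a (ksCoeff a (x 1) (Real.sin (x 2)) (Rsq a x) (H (x 1) / Rsq a x))

/-- The first derivatives of the Kerr–Schild metric with `F = h / R²`, where `h₁ = h'`. -/
noncomputable def ksJet (a r s c ρ h h₁ : ℝ) : Fin 4 → Matrix (Fin 4) (Fin 4) ℝ := fun i =>
  ksMatrix a (ksCoeffJet a r s c (h / ρ) (h₁ / ρ - 2 * r * h / ρ ^ 2)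
    (2 * a ^ 2 * s * c * h / ρ ^ 2) i)

/-- The second derivatives of the Kerr–Schild metric, where `h₁ = h'` and `h₂ = h''`. -/
noncomputable def ksJet' (a r s c ρ h h₁ h₂ : ℝ) : Fin 4 → Fin 4 → Matrix (Fin 4) (Fin 4) ℝ :=
  fun i j => ksMatrix a (ksCoeffJet' a r s c (h / ρ) (h₁ / ρ - 2 * r * h / ρ ^ 2)
    (2 * a ^ 2 * s * c * h / ρ ^ 2)
    (h₂ / ρ - 4 * r * h₁ / ρ ^ 2 + (8 * r ^ 2 / ρ ^ 3 - 2 / ρ ^ 2) * h)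
    (2 * a ^ 2 * s * c * (h₁ / ρ ^ 2 - 4 * r * h / ρ ^ 3))
    (h * (8 * a ^ 4 * s ^ 2 * c ^ 2 / ρ ^ 3 + 2 * a ^ 2 * (c ^ 2 - s ^ 2) / ρ ^ 2)) i j)

/-- The covectors of a real adapted frame, `g = ℓ n + n ℓ - ρ p p - q q / ρ`. -/
def frameL (a s : ℝ) : Fin 4 → ℝ := ![1, 0, 0, -(a * s ^ 2)]
noncomputable def frameN (a r s ρ h : ℝ) : Fin 4 → ℝ :=
  ![(r ^ 2 + a ^ 2 - h) / (2 * ρ), 1, 0, -((r ^ 2 + a ^ 2 - h) / (2 * ρ) * a * s ^ 2)]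
def frameP : Fin 4 → ℝ := ![0, 0, 1, 0]
def frameQ (a r s : ℝ) : Fin 4 → ℝ := ![-(a * s), 0, 0, (r ^ 2 + a ^ 2) * s]

/-- The simple bivector `X ∧ Y`. -/
def wedge (X Y : Fin 4 → ℝ) (a b : Fin 4) : ℝ := X a * Y b - Y a * X b

/-- The general curvature tensor that is boost and rotation invariant in the frame. -/
noncomputable def typeD (ρ : ℝ) (l n p q : Fin 4 → ℝ) (A B D E : ℝ) (a b c d : Fin 4) : ℝ :=
  A * (wedge l n a b * wedge l n c d) + B * (wedge p q a b * wedge p q c d)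
    + 2 * E * (wedge l n a b * wedge p q c d + wedge p q a b * wedge l n c d)
    + D * (ρ * (wedge l p a b * wedge n p c d + wedge n p a b * wedge l p c d)
        + (wedge l q a b * wedge n q c d + wedge n q a b * wedge l q c d) / ρ)
    + E * ((wedge l p a b * wedge n q c d + wedge n q a b * wedge l p c d)
        - (wedge l q a b * wedge n p c d + wedge n p a b * wedge l q c d))

/-- The four curvature coefficients have no part free of `h`, `h₁`, `h₂`, because the background is
flat, and no quadratic part, although the frame itself depends on `h`. -/
noncomputable def curvA (a r c ρ h h₁ h₂ : ℝ) : ℝ :=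
  h * (3 * r ^ 2 - a ^ 2 * c ^ 2) / ρ ^ 3 - 2 * h₁ * r / ρ ^ 2 + h₂ / (2 * ρ)
noncomputable def curvB (a r c ρ h : ℝ) : ℝ := h * (3 * a ^ 2 * c ^ 2 - r ^ 2) / ρ ^ 3
noncomputable def curvD (a r c ρ h h₁ : ℝ) : ℝ :=
  -(h * (r ^ 2 - a ^ 2 * c ^ 2) / ρ ^ 3) + h₁ * r / (2 * ρ ^ 2)
noncomputable def curvE (a r c ρ h h₁ : ℝ) : ℝ :=
  -(2 * h * r * a * c / ρ ^ 3) + h₁ * a * c / (2 * ρ ^ 2)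

/-! ### The algebraic curvature identity -/

theorem ksMatrix_symm (a : ℝ) (v : Fin 7 → ℝ) (i j : Fin 4) :
    ksMatrix a v i j = ksMatrix a v j i := by
  fin_cases i <;> fin_cases j <;> rfl

theorem ksInv_symm (a r s ρ h : ℝ) (i j : Fin 4) : ksInv a r s ρ h i j = ksInv a r s ρ h j i := by
  fin_cases i <;> fin_cases j <;> rfl

theorem ksJet'_symm (a r s c ρ h h₁ h₂ : ℝ) (i j : Fin 4) :
    ksJet' a r s c ρ h h₁ h₂ i j = ksJet' a r s c ρ h h₁ h₂ j i := by
  fin_cases i <;> fin_cases j <;> rfl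

/-- The six coordinate bivectors. -/
def bivectorIndex : Fin 6 → Fin 4 × Fin 4 := ![(0, 1), (0, 2), (0, 3), (1, 2), (1, 3), (2, 3)]

section

variable {a r s c ρ : ℝ} (h h₁ h₂ : ℝ) (hs : s ≠ 0) (hcs : c ^ 2 = 1 - s ^ 2)
  (hρ : ρ = r ^ 2 + a ^ 2 * c ^ 2) (hρ0 : ρ ≠ 0)
include hs hcs hρ hρ0

-- The one brute-force computation of curvature. With `s`, `c`, `ρ`, `h`, `h₁`, `h₂` as plain
-- variables, each of the 21 cases becomes, after clearing denominators, a polynomial identity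
-- modulo c² = 1 - s² and ρ = r² + a²c².
set_option maxHeartbeats 4000000 in
theorem riemannOfJet_bivector {i j : Fin 6} (hij : i ≤ j) :
    riemannOfJet (ksInv a r s ρ h) (ksJet a r s c ρ h h₁) (ksJet' a r s c ρ h h₁ h₂)
        (bivectorIndex i).1 (bivectorIndex i).2 (bivectorIndex j).1 (bivectorIndex j).2
      = typeD ρ (frameL a s) (frameN a r s ρ h) frameP (frameQ a r s) (curvA a r c ρ h h₁ h₂)
          (curvB a r c ρ h) (curvD a r c ρ h h₁) (curvE a r c ρ h h₁)
        (bivectorIndex i).1 (bivectorIndex i).2 (bivectorIndex j).1 (bivectorIndex j).2 := by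
  -- Used as rewrite rules, these bring every polynomial to a normal form of degree at most one in
  -- `c`.
  have hpow : ∀ n m : ℕ, m = n + 2 → c ^ m = c ^ n * (1 - s ^ 2) := by
    rintro n _ rfl
    rw [pow_add, hcs]
  fin_cases i <;> fin_cases j <;> first
    | exact absurd hij (by decide)
    | simp [bivectorIndex, riemannOfJet, typeD, wedge, lowerChristoffel, Fin.sum_univ_four,
        ksJet, ksJet', ksMatrix, ksCoeffJet, ksCoeffJet', frameL, frameN, frameP, frameQ,
        ksInv, curvA, curvB, curvD, curvE] <;>
      field_simp <;> (try rw [hρ]) <;> ring_nf <;>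
      simp only [hpow 0 2 rfl, hpow 1 3 rfl, hpow 2 4 rfl, hpow 3 5 rfl, hpow 4 6 rfl,
        hpow 5 7 rfl, hpow 6 8 rfl, hpow 7 9 rfl, hpow 8 10 rfl, hpow 9 11 rfl, hpow 10 12 rfl] <;> ring

/-- Both sides are antisymmetric in each index pair and symmetric under exchange of the pairs, so
the 21 ordered pairs of coordinate bivectors decide all 256 components. -/
theorem riemannOfJet_kerrSchild (i j k l : Fin 4) :
    riemannOfJet (ksInv a r s ρ h) (ksJet a r s c ρ h h₁) (ksJet' a r s c ρ h h₁ h₂) i j k l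
      = typeD ρ (frameL a s) (frameN a r s ρ h) frameP (frameQ a r s) (curvA a r c ρ h h₁ h₂)
          (curvB a r c ρ h) (curvD a r c ρ h h₁) (curvE a r c ρ h h₁) i j k l := by
  set S := riemannOfJet (ksInv a r s ρ h) (ksJet a r s c ρ h h₁) (ksJet' a r s c ρ h h₁ h₂)
  set T := typeD ρ (frameL a s) (frameN a r s ρ h) frameP (frameQ a r s) (curvA a r c ρ h h₁ h₂)
    (curvB a r c ρ h) (curvD a r c ρ h h₁) (curvE a r c ρ h h₁)
  have hSr : ∀ i j k l, S i j l k = - S i j k l := riemannOfJet_swap_right _ _ _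
  have hSp : ∀ i j k l, S k l i j = S i j k l :=
    riemannOfJet_pair_swap (ksInv_symm _ _ _ _ _) (fun _ => ksMatrix_symm _ _)
      (fun _ _ => ksMatrix_symm _ _) (fun i j a b => by rw [ksJet'_symm])
  have hSl : ∀ i j k l, S j i k l = - S i j k l := fun i j k l => by
    rw [hSp, hSr, hSp]
  have hTr : ∀ i j k l, T i j l k = - T i j k l := fun i j k l => by
    simp only [T, typeD, wedge]; ring
  have hTp : ∀ i j k l, T k l i j = T i j k l := fun i j k l => by
    simp only [T, typeD, wedge]; ring
  have hTl : ∀ i j k l, T j i k l = - T i j k l := fun i j k l => by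
    rw [hTp, hTr, hTp]
  have key : ∀ i j, S (bivectorIndex i).1 (bivectorIndex i).2 (bivectorIndex j).1 (bivectorIndex j).2
      = T (bivectorIndex i).1 (bivectorIndex i).2 (bivectorIndex j).1 (bivectorIndex j).2 := by
    intro i j
    rcases le_total i j with hij | hij
    · exact riemannOfJet_bivector h h₁ h₂ hs hcs hρ hρ0 hij
    · rw [← hSp, ← hTp]
      exact riemannOfJet_bivector h h₁ h₂ hs hcs hρ hρ0 hij
  have cases : ∀ i j : Fin 4, i = j ∨ ∃ m, bivectorIndex m = (i, j) ∨ bivectorIndex m = (j, i) := by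
    decide
  have eq_zero : ∀ {y : ℝ}, y = - y → y = 0 := fun hy => by linarith
  rcases cases i j with rfl | ⟨m, hm⟩
  · rw [eq_zero (hSl i i k l), eq_zero (hTl i i k l)]
  rcases cases k l with rfl | ⟨m', hm'⟩
  · rw [eq_zero (hSr i j k k), eq_zero (hTr i j k k)]
  have := key m m'
  rcases hm with hm | hm <;> rcases hm' with hm' | hm' <;> simp only [hm, hm'] at this
  · exact this
  · rw [hSr, hTr] at this; linarith
  · rw [hSl, hTl] at this; linarith
  · rw [hSl, hTl, hSr, hTr] at this; linarith

/-- As ℓ is null, the inverse of g₀ - Fℓ⊗ℓ is g₀⁻¹ + Fℓ⊗ℓ with raised indices. Raising ℓ gives ∂_r,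
so `h` appears only in the rr entry. -/
theorem ksMatrix_mul_ksInv :
    ksMatrix a (ksCoeff a r s ρ (h / ρ)) * ksInv a r s ρ h = 1 := by
  have hc : c ^ 2 = 1 - s ^ 2 := hcs
  have hρ' : ρ = r ^ 2 + a ^ 2 - a ^ 2 * s ^ 2 := by rw [hρ, hc]; ring
  ext i j
  fin_cases i <;> fin_cases j <;>
    simp [Matrix.mul_apply, Fin.sum_univ_four, ksMatrix, ksCoeff, ksInv] <;> field_simp <;>
    (try rw [hρ']) <;> ring

end

/-! ### Curvature of the Kerr–Schild metrics -/

/-- The metrics are stationary and axisymmetric: only the r and θ derivatives survive, and each is a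
one-variable derivative. -/
theorem hasDerivAt_update_coord {E : Type*} [NormedAddCommGroup E] [NormedSpace ℝ E]
    {f : ℝ → ℝ → E} {f₁ f₂ : E} (x : Pt)
    (h₁ : HasDerivAt (fun r => f r (x 2)) f₁ (x 1))
    (h₂ : HasDerivAt (fun θ => f (x 1) θ) f₂ (x 2)) (i : Fin 4) :
    HasDerivAt (fun t => f (Function.update x i t 1) (Function.update x i t 2))
      ((![0, f₁, f₂, 0] : Fin 4 → E) i) (x i) := by
  fin_cases i
  · simpa using hasDerivAt_const (x 0) (f (x 1) (x 2))
  · simpa using h₁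
  · simpa using h₂
  · simpa using hasDerivAt_const (x 3) (f (x 1) (x 2))

theorem HasDerivAt.ksMatrix {a : ℝ} {v : ℝ → Fin 7 → ℝ} {v' : Fin 7 → ℝ} {t : ℝ}
    (hv : HasDerivAt v v' t) (i j : Fin 4) :
    HasDerivAt (fun t => ksMatrix a (v t) i j) (ksMatrix a v' i j) t := by
  have h := hasDerivAt_pi.1 hv
  have h0 := hasDerivAt_const t (0 : ℝ)
  have h2 := ((h 2).const_mul a).neg
  have h3 := (h 3).const_mul a
  fin_cases i <;> fin_cases j
  exacts [(h 0).sub (h 1), h 0, h0, h3, h 0, h0, h0, h2, h0, h0, (h 5).neg, h0, h3, h2, h0,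
    (h 6).neg.sub ((h 4).const_mul (a ^ 2))]

theorem hasDerivAt_ksCoeff_r {a s c : ℝ} {F Fr : ℝ → ℝ} {ρ : ℝ → ℝ} {r : ℝ}
    (hF : HasDerivAt F (Fr r) r) (hρ : HasDerivAt ρ (2 * r) r) (Ft : ℝ) :
    HasDerivAt (fun r => ksCoeff a r s (ρ r) (F r)) (ksCoeffJet a r s c (F r) (Fr r) Ft 1) r := by
  refine hasDerivAt_pi.2 fun k => ?_
  have h6 : HasDerivAt (fun r : ℝ => (r ^ 2 + a ^ 2) * s ^ 2) (2 * r * s ^ 2) r := by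
    simpa using (((hasDerivAt_pow 2 r).add_const (a ^ 2)).mul_const (s ^ 2))
  fin_cases k
  exacts [hasDerivAt_const _ _, hF, hasDerivAt_const _ _, hF.mul_const _, hF.mul_const _, hρ, h6]

theorem hasDerivAt_ksCoeff_θ {a r : ℝ} {F ρ : ℝ → ℝ} {Ft θ : ℝ} (Fr : ℝ)
    (hF : HasDerivAt F Ft θ)
    (hρ : HasDerivAt ρ (-(2 * a ^ 2 * Real.sin θ * Real.cos θ)) θ) :
    HasDerivAt (fun θ => ksCoeff a r (Real.sin θ) (ρ θ) (F θ))
      (ksCoeffJet a r (Real.sin θ) (Real.cos θ) (F θ) Fr Ft 2) θ := by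
  refine hasDerivAt_pi.2 fun k => ?_
  have hs := Real.hasDerivAt_sin θ
  fin_cases k
  · exact hasDerivAt_const _ _
  · exact hF
  · exact (hs.pow 2).congr_deriv (by simp [ksCoeffJet])
  · exact (hF.mul (hs.pow 2)).congr_deriv (by simp [ksCoeffJet]; ring)
  · exact (hF.mul (hs.pow 4)).congr_deriv (by simp [ksCoeffJet]; ring)
  · exact hρ
  · exact ((hs.pow 2).const_mul (r ^ 2 + a ^ 2)).congr_deriv (by simp [ksCoeffJet]; ring)

theorem hasDerivAt_ksCoeffJet_r {a s c : ℝ} {F Fr Ft : ℝ → ℝ} {Frr Frt r : ℝ}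
    (hF : HasDerivAt F (Fr r) r) (hFr : HasDerivAt Fr Frr r) (hFt : HasDerivAt Ft Frt r)
    (Ftt : ℝ) (j : Fin 4) :
    HasDerivAt (fun r => ksCoeffJet a r s c (F r) (Fr r) (Ft r) j)
      (ksCoeffJet' a r s c (F r) (Fr r) (Ft r) Frr Frt Ftt 1 j) r := by
  have h0 : HasDerivAt (fun _ : ℝ => (0 : Fin 7 → ℝ)) 0 r := hasDerivAt_const _ _
  have hid := hasDerivAt_id r
  have h1 : HasDerivAt (fun r => ksCoeffJet a r s c (F r) (Fr r) (Ft r) 1)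
      (ksCoeffJet' a r s c (F r) (Fr r) (Ft r) Frr Frt Ftt 1 1) r := by
    refine hasDerivAt_pi.2 fun k => ?_
    fin_cases k
    · exact hasDerivAt_const _ _
    · exact hFr
    · exact hasDerivAt_const _ _
    · exact hFr.mul_const _
    · exact hFr.mul_const _
    · exact (hid.const_mul 2).congr_deriv (by simp [ksCoeffJet'])
    · exact ((hid.const_mul 2).mul_const (s ^ 2)).congr_deriv (by simp [ksCoeffJet'])
  have h2 : HasDerivAt (fun r => ksCoeffJet a r s c (F r) (Fr r) (Ft r) 2)
      (ksCoeffJet' a r s c (F r) (Fr r) (Ft r) Frr Frt Ftt 1 2) r := by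
    refine hasDerivAt_pi.2 fun k => ?_
    fin_cases k
    · exact hasDerivAt_const _ _
    · exact hFt
    · exact hasDerivAt_const _ _
    · exact (hFt.mul_const (s ^ 2)).add (((hF.const_mul 2).mul_const s).mul_const c)
    · exact (hFt.mul_const (s ^ 4)).add (((hF.const_mul 4).mul_const (s ^ 3)).mul_const c)
    · exact hasDerivAt_const _ _
    · exact (((((hasDerivAt_pow 2 r).add_const (a ^ 2)).const_mul 2).mul_const s).mul_const
        c).congr_deriv (by simp [ksCoeffJet', show (2 : ℝ) * (2 * r) = 4 * r by ring])
  fin_cases j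
  exacts [h0, h1, h2, h0]

theorem hasDerivAt_ksCoeffJet_θ {a r : ℝ} {F Fr Ft : ℝ → ℝ} {Frt Ftt θ : ℝ} (Frr : ℝ)
    (hF : HasDerivAt F (Ft θ) θ) (hFr : HasDerivAt Fr Frt θ) (hFt : HasDerivAt Ft Ftt θ)
    (j : Fin 4) :
    HasDerivAt (fun θ => ksCoeffJet a r (Real.sin θ) (Real.cos θ) (F θ) (Fr θ) (Ft θ) j)
      (ksCoeffJet' a r (Real.sin θ) (Real.cos θ) (F θ) (Fr θ) (Ft θ) Frr Frt Ftt 2 j) θ := by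
  have h0 : HasDerivAt (fun _ : ℝ => (0 : Fin 7 → ℝ)) 0 θ := hasDerivAt_const _ _
  have hs := Real.hasDerivAt_sin θ
  have hc := Real.hasDerivAt_cos θ
  have h1 : HasDerivAt
      (fun θ => ksCoeffJet a r (Real.sin θ) (Real.cos θ) (F θ) (Fr θ) (Ft θ) 1)
      (ksCoeffJet' a r (Real.sin θ) (Real.cos θ) (F θ) (Fr θ) (Ft θ) Frr Frt Ftt 2 1) θ := by
    refine hasDerivAt_pi.2 fun k => ?_
    fin_cases k
    · exact hasDerivAt_const _ _
    · exact hFr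
    · exact hasDerivAt_const _ _
    · exact (hFr.mul (hs.pow 2)).congr_deriv (by simp [ksCoeffJet']; ring)
    · exact (hFr.mul (hs.pow 4)).congr_deriv (by simp [ksCoeffJet']; ring)
    · exact hasDerivAt_const _ _
    · exact ((hs.pow 2).const_mul (2 * r)).congr_deriv (by simp [ksCoeffJet']; ring)
  have h2 : HasDerivAt
      (fun θ => ksCoeffJet a r (Real.sin θ) (Real.cos θ) (F θ) (Fr θ) (Ft θ) 2)
      (ksCoeffJet' a r (Real.sin θ) (Real.cos θ) (F θ) (Fr θ) (Ft θ) Frr Frt Ftt 2 2) θ := by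
    refine hasDerivAt_pi.2 fun k => ?_
    fin_cases k
    · exact hasDerivAt_const _ _
    · exact hFt
    · exact ((hs.const_mul 2).mul hc).congr_deriv (by simp [ksCoeffJet']; ring)
    · exact ((hFt.mul (hs.pow 2)).add (((hF.const_mul 2).mul hs).mul hc)).congr_deriv
        (by simp [ksCoeffJet']; ring)
    · exact ((hFt.mul (hs.pow 4)).add (((hF.const_mul 4).mul (hs.pow 3)).mul hc)).congr_deriv
        (by simp [ksCoeffJet']; ring)
    · exact ((hs.const_mul (2 * a ^ 2)).mul hc).neg.congr_deriv (by simp [ksCoeffJet']; ring)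
    · exact ((hs.const_mul (2 * (r ^ 2 + a ^ 2))).mul hc).congr_deriv
        (by simp [ksCoeffJet']; ring)
  fin_cases j
  exacts [h0, h1, h2, h0]

theorem Rsq_pos (a : ℝ) {x : Pt} (hx : x ∈ chart) : 0 < Rsq a x := by
  have := hx.1
  simp only [Rsq]
  positivity

theorem sin_pos_of_mem_chart {x : Pt} (hx : x ∈ chart) : 0 < Real.sin (x 2) :=
  Real.sin_pos_of_pos_of_lt_pi hx.2.1 hx.2.2

section

variable {H H₁ H₂ : ℝ → ℝ} (hH : ∀ r, 0 < r → HasDerivAt H (H₁ r) r)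
  (hH₁ : ∀ r, 0 < r → HasDerivAt H₁ (H₂ r) r) (a : ℝ)

theorem kerrSchild_mul_ksInv (H : ℝ → ℝ) {x : Pt} (hx : x ∈ chart) :
    kerrSchild a H x * ksInv a (x 1) (Real.sin (x 2)) (Rsq a x) (H (x 1)) = 1 :=
  ksMatrix_mul_ksInv (H (x 1)) (c := Real.cos (x 2)) (sin_pos_of_mem_chart hx).ne'
    (Real.cos_sq' _) rfl (Rsq_pos a hx).ne'

theorem kerrSchild_inv (H : ℝ → ℝ) {x : Pt} (hx : x ∈ chart) :
    (kerrSchild a H x)⁻¹ = ksInv a (x 1) (Real.sin (x 2)) (Rsq a x) (H (x 1)) :=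
  Matrix.inv_eq_right_inv (kerrSchild_mul_ksInv a H hx)

include hH hH₁

theorem hasMetricJet_kerrSchild :
    HasMetricJet (kerrSchild a H)
      (fun i x => ksJet a (x 1) (Real.sin (x 2)) (Real.cos (x 2)) (Rsq a x) (H (x 1)) (H₁ (x 1)) i)
      (fun i j x => ksJet' a (x 1) (Real.sin (x 2)) (Real.cos (x 2)) (Rsq a x) (H (x 1))
        (H₁ (x 1)) (H₂ (x 1)) i j) := by
  let ρ : ℝ → ℝ → ℝ := fun r θ => r ^ 2 + a ^ 2 * Real.cos θ ^ 2
  have hρr : ∀ r θ, HasDerivAt (fun r => ρ r θ) (2 * r) r := fun r θ =>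
    ((hasDerivAt_pow 2 r).add_const (a ^ 2 * Real.cos θ ^ 2)).congr_deriv (by simp)
  have hρθ : ∀ r θ, HasDerivAt (fun θ => ρ r θ)
      (-(2 * a ^ 2 * Real.sin θ * Real.cos θ)) θ := fun r θ =>
    ((((Real.hasDerivAt_cos θ).pow 2).const_mul (a ^ 2)).const_add (r ^ 2)).congr_deriv
      (by simp; ring)
  have hFr : ∀ x ∈ chart, HasDerivAt (fun r => H r / ρ r (x 2))
      (H₁ (x 1) / ρ (x 1) (x 2) - 2 * x 1 * H (x 1) / ρ (x 1) (x 2) ^ 2) (x 1) := by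
    intro x hx
    have h0 : ρ (x 1) (x 2) ≠ 0 := (Rsq_pos a hx).ne'
    exact ((hH _ hx.1).div (hρr _ _) h0).congr_deriv (by field_simp)
  have hFθ : ∀ (H : ℝ → ℝ), ∀ x ∈ chart, HasDerivAt (fun θ => H (x 1) / ρ (x 1) θ)
      (2 * a ^ 2 * Real.sin (x 2) * Real.cos (x 2) * H (x 1) / ρ (x 1) (x 2) ^ 2) (x 2) := by
    intro H x hx
    have h0 : ρ (x 1) (x 2) ≠ 0 := (Rsq_pos a hx).ne'
    exact ((hasDerivAt_const _ (H (x 1))).div (hρθ _ _) h0).congr_deriv (by field_simp; ring)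
  refine ⟨fun x hx => ?_, fun i x => ksMatrix_symm _ _, fun x hx i b d => ?_,
    fun x hx i j b d => ?_⟩
  · exact (Matrix.isUnit_iff_isUnit_det _).1
      (IsUnit.of_mul_eq_one _ (kerrSchild_mul_ksInv a H hx))
  -- The zeros passed to the two derivative lemmas fill arguments that the row in question does not
  -- contain: the r row has no `Ft`, the θ row no `Fr`. The same holds for `Ftt` and `Frr` in the
  -- second derivatives.
  · have := hasDerivAt_update_coord
      (f := fun r θ => ksCoeff a r (Real.sin θ) (ρ r θ) (H r / ρ r θ)) x
      (hasDerivAt_ksCoeff_r (c := Real.cos (x 2))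
        (Fr := fun r => H₁ r / ρ r (x 2) - 2 * r * H r / ρ r (x 2) ^ 2) (hFr _ hx) (hρr _ _) 0)
      (hasDerivAt_ksCoeff_θ 0 (hFθ H _ hx) (hρθ _ _)) i
    refine (this.ksMatrix b d).congr_deriv ?_
    fin_cases i <;> rfl
  · have hr := hx.1
    have h0 : ρ (x 1) (x 2) ≠ 0 := (Rsq_pos a hx).ne'
    have hs := Real.hasDerivAt_sin (x 2)
    have hc := Real.hasDerivAt_cos (x 2)
    have hFrr : HasDerivAt (fun r => H₁ r / ρ r (x 2) - 2 * r * H r / ρ r (x 2) ^ 2)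
        (H₂ (x 1) / ρ (x 1) (x 2) - 4 * x 1 * H₁ (x 1) / ρ (x 1) (x 2) ^ 2
          + (8 * x 1 ^ 2 / ρ (x 1) (x 2) ^ 3 - 2 / ρ (x 1) (x 2) ^ 2) * H (x 1)) (x 1) :=
      (((hH₁ _ hr).div (hρr _ _) h0).sub ((((hasDerivAt_id _).const_mul 2).mul (hH _ hr)).div
        ((hρr _ _).pow 2) (pow_ne_zero 2 h0))).congr_deriv (by
          simp only [Pi.pow_apply, Pi.mul_apply]
          field_simp
          ring)
    have hFrθ : HasDerivAt
        (fun r => 2 * a ^ 2 * Real.sin (x 2) * Real.cos (x 2) * H r / ρ r (x 2) ^ 2)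
        (2 * a ^ 2 * Real.sin (x 2) * Real.cos (x 2) *
          (H₁ (x 1) / ρ (x 1) (x 2) ^ 2 - 4 * x 1 * H (x 1) / ρ (x 1) (x 2) ^ 3)) (x 1) :=
      (((hH _ hr).const_mul _).div ((hρr _ _).pow 2) (pow_ne_zero 2 h0)).congr_deriv (by
          simp only [Pi.pow_apply]
          field_simp
          ring)
    have hFθr : HasDerivAt
        (fun θ => H₁ (x 1) / ρ (x 1) θ - 2 * x 1 * H (x 1) / ρ (x 1) θ ^ 2)
        (2 * a ^ 2 * Real.sin (x 2) * Real.cos (x 2) *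
          (H₁ (x 1) / ρ (x 1) (x 2) ^ 2 - 4 * x 1 * H (x 1) / ρ (x 1) (x 2) ^ 3)) (x 2) :=
      (((hasDerivAt_const _ (H₁ (x 1))).div (hρθ _ _) h0).sub
        ((hasDerivAt_const _ (2 * x 1 * H (x 1))).div ((hρθ _ _).pow 2)
          (pow_ne_zero 2 h0))).congr_deriv (by
          simp only [Pi.pow_apply]
          field_simp
          ring)
    have hFθθ : HasDerivAt
        (fun θ => 2 * a ^ 2 * Real.sin θ * Real.cos θ * H (x 1) / ρ (x 1) θ ^ 2)
        (H (x 1) * (8 * a ^ 4 * Real.sin (x 2) ^ 2 * Real.cos (x 2) ^ 2 / ρ (x 1) (x 2) ^ 3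
          + 2 * a ^ 2 * (Real.cos (x 2) ^ 2 - Real.sin (x 2) ^ 2) / ρ (x 1) (x 2) ^ 2)) (x 2) :=
      ((((hs.const_mul (2 * a ^ 2)).mul hc).mul_const (H (x 1))).div ((hρθ _ _).pow 2)
        (pow_ne_zero 2 h0)).congr_deriv (by
          simp only [Pi.pow_apply, Pi.mul_apply]
          field_simp
          ring)
    have := hasDerivAt_update_coord
      (f := fun r θ => ksCoeffJet a r (Real.sin θ) (Real.cos θ) (H r / ρ r θ)
        (H₁ r / ρ r θ - 2 * r * H r / ρ r θ ^ 2)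
        (2 * a ^ 2 * Real.sin θ * Real.cos θ * H r / ρ r θ ^ 2) j) x
      (hasDerivAt_ksCoeffJet_r (Fr := fun r => H₁ r / ρ r (x 2) - 2 * r * H r / ρ r (x 2) ^ 2)
        (hFr _ hx) hFrr hFrθ 0 j)
      (hasDerivAt_ksCoeffJet_θ
        (Ft := fun θ => 2 * a ^ 2 * Real.sin θ * Real.cos θ * H (x 1) / ρ (x 1) θ ^ 2)
        0 (hFθ H _ hx) hFθr hFθθ j) i
    refine (this.ksMatrix b d).congr_deriv ?_
    fin_cases i <;> fin_cases j <;> rfl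

theorem riemann_kerrSchild {x : Pt} (hx : x ∈ chart) (i j k l : Fin 4) :
    riemann (kerrSchild a H) i j k l x =
      typeD (Rsq a x) (frameL a (Real.sin (x 2)))
        (frameN a (x 1) (Real.sin (x 2)) (Rsq a x) (H (x 1))) frameP
        (frameQ a (x 1) (Real.sin (x 2)))
        (curvA a (x 1) (Real.cos (x 2)) (Rsq a x) (H (x 1)) (H₁ (x 1)) (H₂ (x 1)))
        (curvB a (x 1) (Real.cos (x 2)) (Rsq a x) (H (x 1)))
        (curvD a (x 1) (Real.cos (x 2)) (Rsq a x) (H (x 1)) (H₁ (x 1)))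
        (curvE a (x 1) (Real.cos (x 2)) (Rsq a x) (H (x 1)) (H₁ (x 1))) i j k l := by
  rw [(hasMetricJet_kerrSchild hH hH₁ a).riemann_eq hx, kerrSchild_inv a H hx]
  exact riemannOfJet_kerrSchild _ _ _ (sin_pos_of_mem_chart hx).ne' (Real.cos_sq' _) rfl
    (Rsq_pos a hx).ne' i j k l

end

/-! ### Contractions in an adapted frame -/

/-- The inner product of covectors defined by an inverse metric. -/
def pairing (gi : Matrix (Fin 4) (Fin 4) ℝ) (X Y : Fin 4 → ℝ) : ℝ :=
  ∑ a, ∑ b, gi a b * (X a * Y b)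

/-- `l, n, p, q` is a frame of covectors with `l, n` null, `⟨l, n⟩ = 1`, `⟨p, p⟩ = - 1 / ρ` and
`⟨q, q⟩ = - ρ`, and other products zero. -/
structure IsAdaptedFrame (gi : Matrix (Fin 4) (Fin 4) ℝ) (ρ : ℝ) (l n p q : Fin 4 → ℝ) : Prop where
  symm : ∀ a b, gi a b = gi b a
  ne_zero : ρ ≠ 0
  ll : pairing gi l l = 0
  ln : pairing gi l n = 1
  lp : pairing gi l p = 0
  lq : pairing gi l q = 0
  nn : pairing gi n n = 0
  np : pairing gi n p = 0
  nq : pairing gi n q = 0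
  pp : pairing gi p p = -1 / ρ
  pq : pairing gi p q = 0
  qq : pairing gi q q = -ρ

/-- The symmetric form `α (l n + n l) + β (ρ p p + q q / ρ)`. -/
noncomputable def frameForm (ρ : ℝ) (l n p q : Fin 4 → ℝ) (α β : ℝ) (a b : Fin 4) : ℝ :=
  α * (l a * n b + n a * l b) + β * (ρ * (p a * p b) + q a * q b / ρ)

theorem isAdaptedFrame_frame {a r s c ρ h : ℝ} (hs : s ≠ 0) (hcs : c ^ 2 = 1 - s ^ 2)
    (hρ : ρ = r ^ 2 + a ^ 2 * c ^ 2) (h0 : ρ ≠ 0) :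
    IsAdaptedFrame (ksInv a r s ρ h) ρ (frameL a s) (frameN a r s ρ h) frameP (frameQ a r s) := by
  have hρ' : ρ = r ^ 2 + a ^ 2 - a ^ 2 * s ^ 2 := by rw [hρ, hcs]; ring
  constructor
  case symm => exact ksInv_symm _ _ _ _ _
  case ne_zero => exact h0
  all_goals
    simp [pairing, Fin.sum_univ_four, ksInv, frameL, frameN, frameP, frameQ] <;> field_simp <;>
      (try rw [hρ']) <;> ring

theorem kerrSchild_eq_frameForm (a : ℝ) (H : ℝ → ℝ) {x : Pt} (hx : x ∈ chart) (i j : Fin 4) :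
    kerrSchild a H x i j = frameForm (Rsq a x) (frameL a (Real.sin (x 2)))
        (frameN a (x 1) (Real.sin (x 2)) (Rsq a x) (H (x 1))) frameP
        (frameQ a (x 1) (Real.sin (x 2))) 1 (-1) i j := by
  have h0 := (Rsq_pos a hx).ne'
  have hρ : Rsq a x = x 1 ^ 2 + a ^ 2 - a ^ 2 * Real.sin (x 2) ^ 2 := by
    rw [Rsq, Real.cos_sq']; ring
  rw [kerrSchild]
  generalize Rsq a x = ρ at *
  fin_cases i <;> fin_cases j <;>
    simp [ksMatrix, ksCoeff, frameForm, frameL, frameN, frameP, frameQ] <;> field_simp <;>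
      (try rw [hρ]) <;> ring

/-- Reduces traces of products of bivectors to inner products of frame covectors, so that
coordinates disappear from the contractions. -/
theorem sum_wedge_mul_wedge (gi : Matrix (Fin 4) (Fin 4) ℝ) (hgi : ∀ a b, gi a b = gi b a)
    (X Y Z W : Fin 4 → ℝ) (a b : Fin 4) :
    ∑ c, ∑ d, gi c d * (wedge X Y d a * wedge Z W b c)
      = pairing gi X W * (Y a * Z b) - pairing gi X Z * (Y a * W b)
        - pairing gi Y W * (X a * Z b) + pairing gi Y Z * (X a * W b) := by
  rw [Finset.sum_comm]
  simp only [pairing, Finset.sum_mul, ← Finset.sum_add_distrib, ← Finset.sum_sub_distrib, wedge]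
  refine Finset.sum_congr rfl fun c _ => Finset.sum_congr rfl fun d _ => ?_
  rw [hgi d c]
  ring

namespace IsAdaptedFrame

variable {gi : Matrix (Fin 4) (Fin 4) ℝ} {ρ : ℝ} {l n p q : Fin 4 → ℝ}
  (hf : IsAdaptedFrame gi ρ l n p q)
include hf

theorem pairing_comm (X Y : Fin 4 → ℝ) : pairing gi X Y = pairing gi Y X := by
  rw [pairing, Finset.sum_comm]
  exact Finset.sum_congr rfl fun a _ => Finset.sum_congr rfl fun b _ => by
    rw [hf.symm b a, mul_comm (X b)]

/-- The `E` terms cancel in the trace. What remains is isotropic on each of the planes of `l`, `n`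
and of `p`, `q`: the Ricci tensor has two double eigenvalues, A + 2D and 2D - B. -/
theorem contract_typeD (A B D E : ℝ) (a b : Fin 4) :
    ∑ c, ∑ d, gi c d * typeD ρ l n p q A B D E d a b c
      = frameForm ρ l n p q (A + 2 * D) (B - 2 * D) a b := by
  have h0 := hf.ne_zero
  have expand : ∀ c d, gi c d * typeD ρ l n p q A B D E d a b c
      = A * (gi c d * (wedge l n d a * wedge l n b c))
        + B * (gi c d * (wedge p q d a * wedge p q b c))
        + 2 * E * (gi c d * (wedge l n d a * wedge p q b c))
        + 2 * E * (gi c d * (wedge p q d a * wedge l n b c))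
        + D * ρ * (gi c d * (wedge l p d a * wedge n p b c))
        + D * ρ * (gi c d * (wedge n p d a * wedge l p b c))
        + D / ρ * (gi c d * (wedge l q d a * wedge n q b c))
        + D / ρ * (gi c d * (wedge n q d a * wedge l q b c))
        + E * (gi c d * (wedge l p d a * wedge n q b c))
        + E * (gi c d * (wedge n q d a * wedge l p b c))
        - E * (gi c d * (wedge l q d a * wedge n p b c))
        - E * (gi c d * (wedge n p d a * wedge l q b c)) := fun c d => by
    rw [typeD]; ring
  simp only [expand, Finset.sum_add_distrib, Finset.sum_sub_distrib, ← Finset.mul_sum,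
    sum_wedge_mul_wedge gi hf.symm, hf.pairing_comm n l, hf.pairing_comm p l,
    hf.pairing_comm q l, hf.pairing_comm p n, hf.pairing_comm q n, hf.pairing_comm q p,
    hf.ll, hf.ln, hf.lp, hf.lq, hf.nn, hf.np, hf.nq, hf.pp, hf.pq, hf.qq, frameForm]
  field_simp
  ring

theorem contract_frameForm (α β : ℝ) :
    ∑ a, ∑ b, gi a b * frameForm ρ l n p q α β a b = 2 * α - 2 * β := by
  have h0 := hf.ne_zero
  have expand : ∀ a b, gi a b * frameForm ρ l n p q α β a b
      = α * (gi a b * (l a * n b)) + α * (gi a b * (n a * l b)) + β * ρ * (gi a b * (p a * p b))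
        + β / ρ * (gi a b * (q a * q b)) := fun a b => by
    rw [frameForm]; ring
  have eq : ∀ X Y, ∑ a, ∑ b, gi a b * (X a * Y b) = pairing gi X Y := fun _ _ => rfl
  simp only [expand, Finset.sum_add_distrib, ← Finset.mul_sum, eq, hf.pairing_comm n l, hf.ln,
    hf.pp, hf.qq]
  field_simp
  ring

end IsAdaptedFrame

/-! ### Evaluation of real tensors on complex vectors -/

/-- The value of a real bilinear form on complex vectors. -/
noncomputable def cbilin (P : Fin 4 → Fin 4 → ℝ) (u v : Fin 4 → ℂ) : ℂ :=
  ∑ a, ∑ b, (P a b : ℂ) * u a * v b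

/-- The value of a real covector on a complex vector. -/
noncomputable def ceval (X : Fin 4 → ℝ) (u : Fin 4 → ℂ) : ℂ := ∑ a, (X a : ℂ) * u a

/-- The value of a real tensor of rank four on complex vectors. -/
noncomputable def cquad (T : Fin 4 → Fin 4 → Fin 4 → Fin 4 → ℝ) (u v w z : Fin 4 → ℂ) : ℂ :=
  ∑ a, ∑ b, ∑ c, ∑ d, (T a b c d : ℂ) * u a * v b * w c * z d

theorem cbilin_outer (X Y : Fin 4 → ℝ) (u v : Fin 4 → ℂ) :
    ∑ a, ∑ b, ((X a : ℂ) * Y b) * u a * v b = ceval X u * ceval Y v := by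
  rw [ceval, ceval, Finset.sum_mul_sum]
  exact Finset.sum_congr rfl fun a _ => Finset.sum_congr rfl fun b _ => by ring

theorem cbilin_frameForm (ρ : ℝ) (l n p q : Fin 4 → ℝ) (α β : ℝ) (u v : Fin 4 → ℂ) :
    cbilin (frameForm ρ l n p q α β) u v
      = α * (ceval l u * ceval n v + ceval n u * ceval l v)
        + β * (ρ * (ceval p u * ceval p v) + ceval q u * ceval q v / ρ) := by
  have expand : ∀ a b, (frameForm ρ l n p q α β a b : ℂ) * u a * v b
      = α * ((l a * n b) * u a * v b) + α * ((n a * l b) * u a * v b)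
        + β * ρ * ((p a * p b) * u a * v b) + β / ρ * ((q a * q b) * u a * v b) := fun a b => by
    rw [frameForm]; push_cast; ring
  simp only [cbilin, expand, Finset.sum_add_distrib, ← Finset.mul_sum, cbilin_outer]
  ring

theorem cbilin_wedge (X Y : Fin 4 → ℝ) (u v : Fin 4 → ℂ) :
    cbilin (wedge X Y) u v = ceval X u * ceval Y v - ceval Y u * ceval X v := by
  have expand : ∀ a b, (wedge X Y a b : ℂ) * u a * v b
      = (X a * Y b) * u a * v b - (Y a * X b) * u a * v b := fun a b => by
    rw [wedge]; push_cast; ring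
  simp only [cbilin, expand, Finset.sum_sub_distrib, cbilin_outer]

theorem cquad_mul (P Q : Fin 4 → Fin 4 → ℝ) (u v w z : Fin 4 → ℂ) :
    cquad (fun a b c d => P a b * Q c d) u v w z = cbilin P u v * cbilin Q w z := by
  simp only [cquad, cbilin, Finset.sum_mul]
  refine Finset.sum_congr rfl fun a _ => Finset.sum_congr rfl fun b _ => ?_
  simp only [Finset.mul_sum]
  refine Finset.sum_congr rfl fun c _ => Finset.sum_congr rfl fun d _ => ?_
  push_cast
  ring

theorem cquad_swap_middle (T : Fin 4 → Fin 4 → Fin 4 → Fin 4 → ℝ) (u v w z : Fin 4 → ℂ) :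
    cquad (fun a b c d => T a c b d) u v w z = cquad T u w v z := by
  simp only [cquad]
  refine Finset.sum_congr rfl fun a _ => ?_
  rw [Finset.sum_comm]
  exact Finset.sum_congr rfl fun b _ => Finset.sum_congr rfl fun c _ =>
    Finset.sum_congr rfl fun d _ => by ring

theorem cquad_swap_right (T : Fin 4 → Fin 4 → Fin 4 → Fin 4 → ℝ) (u v w z : Fin 4 → ℂ) :
    cquad (fun a b c d => T a b d c) u v w z = cquad T u v z w := by
  simp only [cquad]
  refine Finset.sum_congr rfl fun a _ => Finset.sum_congr rfl fun b _ => ?_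
  rw [Finset.sum_comm]
  exact Finset.sum_congr rfl fun c _ => Finset.sum_congr rfl fun d _ => by ring

theorem cquad_mul_middle (P Q : Fin 4 → Fin 4 → ℝ) (u v w z : Fin 4 → ℂ) :
    cquad (fun a b c d => P a c * Q b d) u v w z = cbilin P u w * cbilin Q v z := by
  rw [← cquad_mul, ← cquad_swap_middle]

theorem cquad_mul_outer (P Q : Fin 4 → Fin 4 → ℝ) (u v w z : Fin 4 → ℂ) :
    cquad (fun a b c d => P a d * Q b c) u v w z = cbilin P u z * cbilin Q v w := by
  rw [← cquad_mul_middle, ← cquad_swap_right]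

theorem cquad_typeD (ρ : ℝ) (l n p q : Fin 4 → ℝ) (A B D E : ℝ) (u v w z : Fin 4 → ℂ) :
    cquad (typeD ρ l n p q A B D E) u v w z =
      A * (cbilin (wedge l n) u v * cbilin (wedge l n) w z)
      + B * (cbilin (wedge p q) u v * cbilin (wedge p q) w z)
      + 2 * E * (cbilin (wedge l n) u v * cbilin (wedge p q) w z
          + cbilin (wedge p q) u v * cbilin (wedge l n) w z)
      + D * (ρ * (cbilin (wedge l p) u v * cbilin (wedge n p) w z
            + cbilin (wedge n p) u v * cbilin (wedge l p) w z)
          + (cbilin (wedge l q) u v * cbilin (wedge n q) w z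
            + cbilin (wedge n q) u v * cbilin (wedge l q) w z) / ρ)
      + E * ((cbilin (wedge l p) u v * cbilin (wedge n q) w z
            + cbilin (wedge n q) u v * cbilin (wedge l p) w z)
          - (cbilin (wedge l q) u v * cbilin (wedge n p) w z
            + cbilin (wedge n p) u v * cbilin (wedge l q) w z)) := by
  have expand : ∀ a b c d, (typeD ρ l n p q A B D E a b c d : ℂ) * u a * v b * w c * z d
      = A * (((wedge l n a b * wedge l n c d : ℝ) : ℂ) * u a * v b * w c * z d)
      + B * (((wedge p q a b * wedge p q c d : ℝ) : ℂ) * u a * v b * w c * z d)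
      + 2 * E * (((wedge l n a b * wedge p q c d : ℝ) : ℂ) * u a * v b * w c * z d)
      + 2 * E * (((wedge p q a b * wedge l n c d : ℝ) : ℂ) * u a * v b * w c * z d)
      + D * ρ * (((wedge l p a b * wedge n p c d : ℝ) : ℂ) * u a * v b * w c * z d)
      + D * ρ * (((wedge n p a b * wedge l p c d : ℝ) : ℂ) * u a * v b * w c * z d)
      + D / ρ * (((wedge l q a b * wedge n q c d : ℝ) : ℂ) * u a * v b * w c * z d)
      + D / ρ * (((wedge n q a b * wedge l q c d : ℝ) : ℂ) * u a * v b * w c * z d)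
      + E * (((wedge l p a b * wedge n q c d : ℝ) : ℂ) * u a * v b * w c * z d)
      + E * (((wedge n q a b * wedge l p c d : ℝ) : ℂ) * u a * v b * w c * z d)
      - E * (((wedge l q a b * wedge n p c d : ℝ) : ℂ) * u a * v b * w c * z d)
      - E * (((wedge n p a b * wedge l q c d : ℝ) : ℂ) * u a * v b * w c * z d) :=
    fun a b c d => by rw [typeD]; push_cast; ring
  have eq : ∀ P Q : Fin 4 → Fin 4 → ℝ, ∑ a, ∑ b, ∑ c, ∑ d,
      ((P a b * Q c d : ℝ) : ℂ) * u a * v b * w c * z d = cbilin P u v * cbilin Q w z :=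
    fun P Q => cquad_mul P Q u v w z
  rw [cquad]
  simp only [expand, Finset.sum_add_distrib, Finset.sum_sub_distrib, ← Finset.mul_sum, eq]
  ring

theorem ceval_raise (g : MetricField) (x : Pt) (X Y : Fin 4 → ℝ) :
    ceval X (raise g x fun i => (Y i : ℂ)) = (pairing (g x)⁻¹ X Y : ℂ) := by
  simp only [ceval, raise, pairing, Finset.mul_sum]
  push_cast
  exact Finset.sum_congr rfl fun a _ => Finset.sum_congr rfl fun b _ => by ring

/-- The complex vector m is a combination of the real covectors p and q, so evaluating on it comes
down to real pairings. -/
theorem ceval_raise_combination (g : MetricField) (x : Pt) (X Y Z : Fin 4 → ℝ) (y z : ℂ) :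
    ceval X (raise g x fun i => y * Y i + z * Z i)
      = y * (pairing (g x)⁻¹ X Y : ℂ) + z * (pairing (g x)⁻¹ X Z : ℂ) := by
  rw [← ceval_raise, ← ceval_raise]
  simp only [ceval, raise, Finset.mul_sum, ← Finset.sum_add_distrib]
  exact Finset.sum_congr rfl fun a _ => Finset.sum_congr rfl fun b _ => by ring

/-! ### Curvature scalars in an adapted frame -/

/-- The sum of the squared eigenvalues α and -β, each of multiplicity two. -/
theorem IsAdaptedFrame.contract_frameForm_sq {gi : Matrix (Fin 4) (Fin 4) ℝ} {ρ : ℝ}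
    {l n p q : Fin 4 → ℝ} (hf : IsAdaptedFrame gi ρ l n p q) (α β : ℝ) :
    ∑ a, ∑ b, ∑ c, ∑ d, gi a c * gi b d * frameForm ρ l n p q α β a b
      * frameForm ρ l n p q α β c d = 2 * α ^ 2 + 2 * β ^ 2 := by
  have h0 := hf.ne_zero
  have outer : ∀ X Y Z W : Fin 4 → ℝ,
      ∑ a, ∑ b, ∑ c, ∑ d, gi a c * gi b d * (X a * Y b) * (Z c * W d)
        = pairing gi X Z * pairing gi Y W := by
    intro X Y Z W
    simp only [pairing, Finset.sum_mul]
    refine Finset.sum_congr rfl fun a _ => ?_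
    rw [Finset.sum_comm]
    refine Finset.sum_congr rfl fun c _ => ?_
    simp only [Finset.mul_sum]
    exact Finset.sum_congr rfl fun b _ => Finset.sum_congr rfl fun d _ => by ring
  have half : ∀ X Y : Fin 4 → ℝ,
      ∑ a, ∑ b, ∑ c, ∑ d, gi a c * gi b d * (X a * Y b) * frameForm ρ l n p q α β c d
        = α * (pairing gi X l * pairing gi Y n + pairing gi X n * pairing gi Y l)
          + β * (ρ * (pairing gi X p * pairing gi Y p)
            + pairing gi X q * pairing gi Y q / ρ) := by
    intro X Y
    have expand : ∀ a b c d, gi a c * gi b d * (X a * Y b) * frameForm ρ l n p q α β c d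
        = α * (gi a c * gi b d * (X a * Y b) * (l c * n d))
          + α * (gi a c * gi b d * (X a * Y b) * (n c * l d))
          + β * ρ * (gi a c * gi b d * (X a * Y b) * (p c * p d))
          + β / ρ * (gi a c * gi b d * (X a * Y b) * (q c * q d)) := fun a b c d => by
      rw [frameForm]; ring
    simp only [expand, Finset.sum_add_distrib, ← Finset.mul_sum, outer]
    ring
  have expand : ∀ a b c d, gi a c * gi b d * frameForm ρ l n p q α β a b
        * frameForm ρ l n p q α β c d
      = α * (gi a c * gi b d * (l a * n b) * frameForm ρ l n p q α β c d)
        + α * (gi a c * gi b d * (n a * l b) * frameForm ρ l n p q α β c d)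
        + β * ρ * (gi a c * gi b d * (p a * p b) * frameForm ρ l n p q α β c d)
        + β / ρ * (gi a c * gi b d * (q a * q b) * frameForm ρ l n p q α β c d) :=
    fun a b c d => by
      have : frameForm ρ l n p q α β a b = α * (l a * n b) + α * (n a * l b)
        + β * ρ * (p a * p b) + β / ρ * (q a * q b) := by rw [frameForm]; ring
      rw [this]; ring
  simp only [expand, Finset.sum_add_distrib, ← Finset.mul_sum, half,
    hf.pairing_comm n l, hf.pairing_comm p l,
    hf.pairing_comm q l, hf.pairing_comm p n, hf.pairing_comm q n, hf.pairing_comm q p,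
    hf.ll, hf.ln, hf.lp, hf.lq, hf.nn, hf.np, hf.nq, hf.pp, hf.pq, hf.qq]
  field_simp
  ring

/-- The curvature of `g` at `x` is of the type of `typeD` in an adapted frame. -/
structure IsTypeDAt (g : MetricField) (x : Pt) (ρ : ℝ) (l n p q : Fin 4 → ℝ) (A B D E : ℝ) :
    Prop where
  frame : IsAdaptedFrame (g x)⁻¹ ρ l n p q
  metric : ∀ a b, g x a b = frameForm ρ l n p q 1 (-1) a b
  riemann : ∀ a b c d, riemann g a b c d x = typeD ρ l n p q A B D E a b c d
  ricci : ∀ a b, ricci g a b x = ∑ c, ∑ d, (g x)⁻¹ c d * _root_.riemann g d a b c x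

/-- The tetrad `T` consists at `x` of `l`, `n` and `m = μ (ρ p + i q)`. -/
structure NullTetrad.IsAdaptedAt (T : NullTetrad) (x : Pt) (ρ : ℝ) (l n p q : Fin 4 → ℝ)
    (μ : ℂ) : Prop where
  l_eq : T.l x = l
  n_eq : T.n x = n
  m_eq : T.m x = fun i => μ * ρ * p i + μ * Complex.I * q i
  norm : μ * star μ = 1 / (2 * ρ)

namespace IsTypeDAt

variable {g : MetricField} {x : Pt} {ρ : ℝ} {l n p q : Fin 4 → ℝ} {A B D E : ℝ}
  (h : IsTypeDAt g x ρ l n p q A B D E)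
include h

theorem ricci_eq (a b : Fin 4) :
    _root_.ricci g a b x = frameForm ρ l n p q (A + 2 * D) (B - 2 * D) a b := by
  simp only [h.ricci, h.riemann, h.frame.contract_typeD]

theorem scalarCurv_eq : scalarCurv g x = 2 * (A + 2 * D) - 2 * (B - 2 * D) := by
  simp only [scalarCurv, h.ricci_eq, h.frame.contract_frameForm]

theorem ricciSq_eq : ricciSq g x = 2 * (A + 2 * D) ^ 2 + 2 * (B - 2 * D) ^ 2 := by
  simp only [ricciSq, h.ricci_eq, h.frame.contract_frameForm_sq]

variable {T : NullTetrad} {μ : ℂ} (hT : T.IsAdaptedAt x ρ l n p q μ)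
include hT

omit h in
theorem ceval_raise_m (X : Fin 4 → ℝ) :
    ceval X (raise g x (T.m x))
        = μ * ρ * (pairing (g x)⁻¹ X p : ℂ) + μ * Complex.I * (pairing (g x)⁻¹ X q : ℂ) ∧
      ceval X (raise g x fun i => star (T.m x i))
        = star μ * ρ * (pairing (g x)⁻¹ X p : ℂ)
          - star μ * Complex.I * (pairing (g x)⁻¹ X q : ℂ) := by
  have hstar : (fun i => star (T.m x i)) = fun i => star μ * ρ * p i
      + -(star μ * Complex.I) * q i := by
    funext i
    simp [hT.m_eq]
  rw [hstar, hT.m_eq, ceval_raise_combination, ceval_raise_combination]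
  exact ⟨rfl, by ring⟩

/-- The scalar φ₁₁ sees only the trace-free part of the Ricci form, that is α + β = (A + 2D) + (B -
2D), and `D` cancels. -/
theorem npPhi11_eq : npPhi11 g T x = ((-(1 / 4) * (A + B) : ℝ) : ℂ) := by
  have h0 : (ρ : ℂ) ≠ 0 := Complex.ofReal_ne_zero.2 h.frame.ne_zero
  have hμ := hT.norm
  have hcbilin : ∀ u v : Fin 4 → ℂ, ∑ a, ∑ b,
      (frameForm ρ l n p q (A + 2 * D) (B - 2 * D) a b : ℂ) * (u a * v b)
        = cbilin (frameForm ρ l n p q (A + 2 * D) (B - 2 * D)) u v := fun u v =>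
    Finset.sum_congr rfl fun a _ => Finset.sum_congr rfl fun b _ => by ring
  simp only [npPhi11, h.ricci_eq, mul_add, Finset.sum_add_distrib, hcbilin, cbilin_frameForm,
    ceval_raise_m hT, hT.l_eq, hT.n_eq, ceval_raise,
    h.frame.pairing_comm n l, h.frame.pairing_comm p l, h.frame.pairing_comm q l,
    h.frame.pairing_comm p n, h.frame.pairing_comm q n, h.frame.pairing_comm q p,
    h.frame.ll, h.frame.ln, h.frame.lp, h.frame.lq, h.frame.nn, h.frame.np, h.frame.nq,
    h.frame.pp, h.frame.pq, h.frame.qq]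
  push_cast
  have hI := Complex.I_sq
  -- Of the conjugate of μ only the normalization 2ρ|μ|² = 1 matters; the rest is algebra modulo
  -- this and I² = -1.
  generalize star μ = ν at *
  rw [eq_div_iff (by simpa using h0)] at hμ
  field_simp
  linear_combination (-(ρ * (B - 2 * D))) * hμ + ρ ^ 2 * (B - 2 * D) * μ * ν * hI

/-- The Riemann part contributes D + iE, the factor i coming from m = μ(ρp + iq). The Ricci terms of
the Weyl tensor contribute only a trace, and (A + 4D - B)/6 is one twelfth of the scalar curvature.
-/
theorem npPsi2_eq :
    npPsi2 g T x = D + Complex.I * E - ((A + 4 * D - B) / 6 : ℝ) := by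
  have h0 : (ρ : ℂ) ≠ 0 := Complex.ofReal_ne_zero.2 h.frame.ne_zero
  have hμ := hT.norm
  set u := raise g x fun i => (T.l x i : ℂ) with hu
  set v := raise g x (T.m x) with hv
  set w := raise g x (fun i => star (T.m x i)) with hw
  set z := raise g x (fun i => (T.n x i : ℂ)) with hz
  let G := frameForm ρ l n p q 1 (-1)
  let R := frameForm ρ l n p q (A + 2 * D) (B - 2 * D)
  have expand : ∀ a b c d, (weyl g a b c d x : ℂ) * u a * v b * w c * z d
      = ((typeD ρ l n p q A B D E a b c d : ℝ) : ℂ) * u a * v b * w c * z d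
        + 1 / 2 * (((G a c * R b d : ℝ) : ℂ) * u a * v b * w c * z d)
        - 1 / 2 * (((G a d * R b c : ℝ) : ℂ) * u a * v b * w c * z d)
        - 1 / 2 * (((R a d * G b c : ℝ) : ℂ) * u a * v b * w c * z d)
        + 1 / 2 * (((R a c * G b d : ℝ) : ℂ) * u a * v b * w c * z d)
        - (scalarCurv g x / 6 : ℝ) * (((G a c * G b d : ℝ) : ℂ) * u a * v b * w c * z d)
        + (scalarCurv g x / 6 : ℝ) * (((G a d * G b c : ℝ) : ℂ) * u a * v b * w c * z d) := by
    intro a b c d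
    simp only [weyl, h.riemann, h.ricci_eq, h.metric, G, R]
    push_cast
    ring
  have hmid : ∀ P Q : Fin 4 → Fin 4 → ℝ, ∑ a, ∑ b, ∑ c, ∑ d,
      ((P a c * Q b d : ℝ) : ℂ) * u a * v b * w c * z d = cbilin P u w * cbilin Q v z :=
    fun P Q => cquad_mul_middle P Q u v w z
  have hout : ∀ P Q : Fin 4 → Fin 4 → ℝ, ∑ a, ∑ b, ∑ c, ∑ d,
      ((P a d * Q b c : ℝ) : ℂ) * u a * v b * w c * z d = cbilin P u z * cbilin Q v w :=
    fun P Q => cquad_mul_outer P Q u v w z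
  have hD : ∑ a, ∑ b, ∑ c, ∑ d, ((typeD ρ l n p q A B D E a b c d : ℝ) : ℂ)
      * u a * v b * w c * z d = cquad (typeD ρ l n p q A B D E) u v w z := rfl
  have hlhs : npPsi2 g T x = -∑ a, ∑ b, ∑ c, ∑ d, (weyl g a b c d x : ℂ)
      * u a * v b * w c * z d := rfl
  rw [hlhs]
  simp only [expand, Finset.sum_add_distrib, Finset.sum_sub_distrib, ← Finset.mul_sum, hmid, hout,
    hD, cquad_typeD, cbilin_wedge, G, R, cbilin_frameForm, h.scalarCurv_eq]
  simp only [hu, hv, hw, hz, ceval_raise_m hT, hT.l_eq, hT.n_eq, ceval_raise,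
    h.frame.pairing_comm n l, h.frame.pairing_comm p l, h.frame.pairing_comm q l,
    h.frame.pairing_comm p n, h.frame.pairing_comm q n, h.frame.pairing_comm q p,
    h.frame.ll, h.frame.ln, h.frame.lp, h.frame.lq, h.frame.nn, h.frame.np, h.frame.nq,
    h.frame.pp, h.frame.pq, h.frame.qq]
  push_cast
  have hI := Complex.I_sq
  generalize star μ = ν at *
  rw [eq_div_iff (by simpa using h0)] at hμ
  field_simp
  linear_combination (ρ * (-2 * A + 12 * Complex.I * E + 2 * B + 4 * D)) * hμ
    + μ * ν * ρ ^ 2 * (2 * A - 2 * B - 4 * D) * hI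

end IsTypeDAt

/-! ### Black hole families of Kerr–Newman form -/

theorem isTypeDAt_kerrSchild {a : ℝ} {g : MetricField} {H H₁ H₂ : ℝ → ℝ}
    (hg : EqOn g (kerrSchild a H) chart)
    (hH : ∀ r, 0 < r → HasDerivAt H (H₁ r) r) (hH₁ : ∀ r, 0 < r → HasDerivAt H₁ (H₂ r) r)
    {x : Pt} (hx : x ∈ chart) :
    IsTypeDAt g x (Rsq a x) (frameL a (Real.sin (x 2)))
        (frameN a (x 1) (Real.sin (x 2)) (Rsq a x) (H (x 1))) frameP
        (frameQ a (x 1) (Real.sin (x 2)))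
        (curvA a (x 1) (Real.cos (x 2)) (Rsq a x) (H (x 1)) (H₁ (x 1)) (H₂ (x 1)))
        (curvB a (x 1) (Real.cos (x 2)) (Rsq a x) (H (x 1)))
        (curvD a (x 1) (Real.cos (x 2)) (Rsq a x) (H (x 1)) (H₁ (x 1)))
        (curvE a (x 1) (Real.cos (x 2)) (Rsq a x) (H (x 1)) (H₁ (x 1))) where
  frame := by
    rw [hg hx, kerrSchild_inv a H hx]
    exact isAdaptedFrame_frame (sin_pos_of_mem_chart hx).ne' (Real.cos_sq' _) rfl
      (Rsq_pos a hx).ne'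
  metric i j := by rw [hg hx, kerrSchild_eq_frameForm a H hx]
  riemann i j k l := by rw [riemann_congr hg _ _ _ _ hx, riemann_kerrSchild hH hH₁ a hx]
  ricci i j := by
    simp only [ricci_congr hg _ _ hx, riemann_congr hg _ _ _ _ hx, hg hx]
    exact (hasMetricJet_kerrSchild hH hH₁ a).ricci_eq hx i j

/-- The function `H = 2 M r - e(r)² + Λ* r⁴ / 3`. -/
noncomputable def massFun (L M : ℝ) (ε : ℝ → ℝ) (r : ℝ) : ℝ := 2 * M * r - ε r ^ 2 + L * r ^ 4 / 3

/-- The frame coefficient `μ = - 1 / (√2 R)` of the covector `m = μ (R² p + i q)`. -/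
noncomputable def frameCoeff (a : ℝ) (x : Pt) : ℂ := -(1 / ((√2 : ℝ) * Rc a x))

/-- On the chart the family `F` coincides with the Kerr–Newman–de Sitter family. -/
structure IsKerrNewmanForm (F : BlackHoleFamily) (a L : ℝ) : Prop where
  metric : ∀ M ε, EqOn (F.metric M ε) (kerrSchild a (massFun L M ε)) chart
  l_eq : ∀ M ε, ∀ x ∈ chart, (F.tetrad M ε).l x = frameL a (Real.sin (x 2))
  n_eq : ∀ M ε, ∀ x ∈ chart, (F.tetrad M ε).n x =
    frameN a (x 1) (Real.sin (x 2)) (Rsq a x) (massFun L M ε (x 1))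
  m_eq : ∀ M ε, ∀ x ∈ chart, (F.tetrad M ε).m x = fun i =>
    frameCoeff a x * Rsq a x * frameP i
      + frameCoeff a x * Complex.I * frameQ a (x 1) (Real.sin (x 2)) i
  lambdaC : ∀ x ∈ chart, F.lambdaC x = (knDeSitter a L).lambdaC x
  phi11C : ∀ x ∈ chart, F.phi11C x = (knDeSitter a L).phi11C x
  maxwell : ∀ e, ∀ x ∈ chart, F.maxwell e x = (knDeSitter a L).maxwell e x

theorem Rc_mul_star (a : ℝ) (x : Pt) : Rc a x * star (Rc a x) = (Rsq a x : ℂ) := by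
  have hI := Complex.I_sq
  simp only [Rc, Rsq, star_add, star_mul', Complex.star_def, Complex.conj_ofReal, Complex.conj_I]
  push_cast
  linear_combination (-((a : ℂ) ^ 2 * Complex.cos (x 2) ^ 2)) * hI

theorem Rc_ne_zero (a : ℝ) {x : Pt} (hx : x ∈ chart) : Rc a x ≠ 0 := by
  intro h
  have := Rc_mul_star a x
  rw [h, zero_mul] at this
  exact (Rsq_pos a hx).ne' (by exact_mod_cast this.symm)

theorem frameCoeff_norm (a : ℝ) (x : Pt) :
    frameCoeff a x * star (frameCoeff a x) = 1 / (2 * (Rsq a x : ℂ)) := by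
  have h2 : ((√2 : ℝ) : ℂ) * ((√2 : ℝ) : ℂ) = 2 := by
    rw [← Complex.ofReal_mul, Real.mul_self_sqrt (by norm_num)]
    norm_num
  have hstar : star (frameCoeff a x) = -(1 / ((√2 : ℝ) * star (Rc a x))) := by
    simp [frameCoeff]
  rw [hstar, frameCoeff, neg_mul_neg, div_mul_div_comm, ← Rc_mul_star, ← h2]
  congr 1 <;> ring

namespace IsKerrNewmanForm

variable {F : BlackHoleFamily} {a L : ℝ} (hF : IsKerrNewmanForm F a L)
include hF

theorem isAdaptedAt (M : ℝ) (ε : ℝ → ℝ) {x : Pt} (hx : x ∈ chart) :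
    (F.tetrad M ε).IsAdaptedAt x (Rsq a x) (frameL a (Real.sin (x 2)))
        (frameN a (x 1) (Real.sin (x 2)) (Rsq a x) (massFun L M ε (x 1))) frameP
        (frameQ a (x 1) (Real.sin (x 2))) (frameCoeff a x) :=
  ⟨hF.l_eq M ε x hx, hF.n_eq M ε x hx, hF.m_eq M ε x hx, frameCoeff_norm a x⟩

/-- The parameters enter only through H, and the uu entry 1 - H/R² recovers H. Hence a part of e(r)²
linear in r is indistinguishable from mass. -/
theorem metric_eq_iff {M M' : ℝ} {ε ε' : ℝ → ℝ} {x : Pt} (hx : x ∈ chart) :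
    F.metric M ε x = F.metric M' ε' x ↔ massFun L M ε (x 1) = massFun L M' ε' (x 1) := by
  rw [hF.metric _ _ hx, hF.metric _ _ hx]
  refine ⟨fun h => ?_, fun h => by simp only [kerrSchild, h]⟩
  have := congrFun (congrFun h 0) 0
  simp only [kerrSchild, ksMatrix, ksCoeff, Matrix.of_apply, Matrix.cons_val_zero,
    Matrix.cons_val_one, sub_right_inj] at this
  exact (div_left_inj' (Rsq_pos a hx).ne').1 this

/-- The Einstein–Maxwell conditions in terms of `q = e(r)²`. -/
theorem field_iff {M e : ℝ} {ε q₁ q₂ : ℝ → ℝ}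
    (hq : ∀ r, 0 < r → HasDerivAt (fun r => ε r ^ 2) (q₁ r) r)
    (hq₁ : ∀ r, 0 < r → HasDerivAt q₁ (q₂ r) r) :
    HasElectromagneticField F e M ε ↔ ∀ r, 0 < r → q₂ r = 0 ∧ ε r ^ 2 - r * q₁ r = e ^ 2 := by
  let H₁ : ℝ → ℝ := fun r => 2 * M - q₁ r + 4 * L * r ^ 3 / 3
  let H₂ : ℝ → ℝ := fun r => -q₂ r + 4 * L * r ^ 2
  have hH : ∀ r, 0 < r → HasDerivAt (massFun L M ε) (H₁ r) r := fun r hr =>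
    ((((hasDerivAt_id r).const_mul (2 * M)).sub (hq r hr)).add
      (((hasDerivAt_pow 4 r).const_mul L).div_const 3)).congr_deriv (by simp [H₁]; ring)
  have hH₁ : ∀ r, 0 < r → HasDerivAt H₁ (H₂ r) r := fun r hr =>
    (((hq₁ r hr).const_sub (2 * M)).add
      (((hasDerivAt_pow 3 r).const_mul (4 * L)).div_const 3)).congr_deriv (by simp [H₂]; ring)
  -- The combination A + 4D - B collapses to H''/(2R²): the mass disappears and the r⁴ term gives
  -- `lambdaC`.
  have hΛ : ∀ x ∈ chart, npLambda (F.metric M ε) x - F.lambdaC x = -q₂ (x 1) / (24 * Rsq a x) := by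
    intro x hx
    have h0 := (Rsq_pos a hx).ne'
    rw [npLambda, (isTypeDAt_kerrSchild (hF.metric M ε) hH hH₁ hx).scalarCurv_eq,
      hF.lambdaC x hx]
    have hρ : Rsq a x = x 1 ^ 2 + a ^ 2 * Real.cos (x 2) ^ 2 := rfl
    simp only [knDeSitter, curvA, curvB, curvD, H₁, H₂]
    generalize Rsq a x = ρ at *
    field_simp
    rw [hρ]
    ring
  -- Here A + B = 2(H - rH')/R⁴ + H''/(2R²). The mass cancels in H - rH', and the r⁴ term gives
  -- `phi11C`.
  have hΦ : ∀ x ∈ chart, npPhi11 (F.metric M ε) (F.tetrad M ε) x - (F.phi11C x : ℂ)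
      = ((((ε (x 1) ^ 2 - x 1 * q₁ (x 1)) / (2 * Rsq a x ^ 2) + q₂ (x 1) / (8 * Rsq a x)) : ℝ) : ℂ) := by
    intro x hx
    have h0 := (Rsq_pos a hx).ne'
    rw [(isTypeDAt_kerrSchild (hF.metric M ε) hH hH₁ hx).npPhi11_eq (hF.isAdaptedAt M ε hx),
      hF.phi11C x hx, ← Complex.ofReal_sub]
    have hρ : Rsq a x = x 1 ^ 2 + a ^ 2 * Real.cos (x 2) ^ 2 := rfl
    simp only [knDeSitter, curvA, curvB, H₁, H₂, massFun]
    generalize Rsq a x = ρ at *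
    congr 1
    field_simp
    rw [hρ]
    ring
  have hmax : ∀ x ∈ chart, F.maxwell e x * star (F.maxwell e x)
      = ((e ^ 2 / (2 * Rsq a x ^ 2) : ℝ) : ℂ) := by
    intro x hx
    have h2 : ((√2 : ℝ) : ℂ) * ((√2 : ℝ) : ℂ) = 2 := by
      rw [← Complex.ofReal_mul, Real.mul_self_sqrt (by norm_num)]
      norm_num
    have hstar : star ((e : ℂ) / ((√2 : ℝ) * star (Rc a x) ^ 2)) = e / ((√2 : ℝ) * Rc a x ^ 2) := by
      simp
    rw [hF.maxwell e x hx]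
    simp only [knDeSitter]
    rw [hstar, div_mul_div_comm]
    push_cast
    rw [← Rc_mul_star, ← h2]
    congr 1 <;> ring
  constructor
  · intro h r hr
    let x : Pt := ![0, r, Real.pi / 2, 0]
    have hx : x ∈ chart := ⟨hr, by simp [x]; positivity, by simp [x]; linarith [Real.pi_pos]⟩
    obtain ⟨h1, h2⟩ := h x hx
    have h0 := Rsq_pos a hx
    rw [hΛ x hx, div_eq_zero_iff] at h1
    have hq2 : q₂ r = 0 := by
      rcases h1 with h1 | h1
      · simpa [x] using h1
      · linarith
    refine ⟨hq2, ?_⟩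
    rw [hΦ x hx, hmax x hx] at h2
    have h3 := Complex.ofReal_injective h2
    have hx1 : x 1 = r := rfl
    rw [hx1, hq2, zero_div, add_zero] at h3
    exact (div_left_inj' (by positivity)).1 h3
  · intro h x hx
    obtain ⟨h1, h2⟩ := h (x 1) hx.1
    rw [hΛ x hx, hΦ x hx, hmax x hx, h1, h2]
    simp

end IsKerrNewmanForm

/-! ### Electrical radiation -/

theorem exists_hasDerivAt_sq {ε : ℝ → ℝ} (hε : ContDiffOn ℝ 2 ε (Ioi 0)) :
    ∃ q₁ q₂ : ℝ → ℝ, (∀ r, 0 < r → HasDerivAt (fun r => ε r ^ 2) (q₁ r) r) ∧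
      ∀ r, 0 < r → HasDerivAt q₁ (q₂ r) r := by
  have hq : ContDiffOn ℝ 2 (fun r => ε r ^ 2) (Ioi 0) := hε.pow 2
  have hq₁ : ContDiffOn ℝ 1 (deriv fun r => ε r ^ 2) (Ioi 0) :=
    hq.deriv_of_isOpen isOpen_Ioi (by norm_num)
  refine ⟨deriv fun r => ε r ^ 2, deriv (deriv fun r => ε r ^ 2), fun r hr => ?_, fun r hr => ?_⟩
  · exact ((hq.differentiableOn (by norm_num)).differentiableAt (Ioi_mem_nhds hr)).hasDerivAt
  · exact ((hq₁.differentiableOn (by norm_num)).differentiableAt (Ioi_mem_nhds hr)).hasDerivAt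

/-- The equation says that (q - k)/r has derivative zero, hence is constant on the half-line. -/
theorem exists_sq_eq_of_sub_mul_deriv {q q₁ : ℝ → ℝ} {k : ℝ}
    (hq : ∀ r, 0 < r → HasDerivAt q (q₁ r) r) (h : ∀ r, 0 < r → q r - r * q₁ r = k) :
    ∃ b, ∀ r, 0 < r → q r = b * r + k := by
  have hd : ∀ r, 0 < r → HasDerivAt (fun r => (q r - k) / r) 0 r := fun r hr =>
    (((hq r hr).sub_const k).div (hasDerivAt_id r) hr.ne').congr_deriv (by
      have := h r hr
      simp only [id]
      rw [div_eq_zero_iff]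
      left
      linarith)
  have hconst : ∀ r, 0 < r → (q r - k) / r = (q 1 - k) / 1 := fun r hr =>
    isOpen_Ioi.is_const_of_deriv_eq_zero (convex_Ioi 0).isPreconnected
      (fun s hs => (hd s hs).differentiableAt.differentiableWithinAt)
      (fun s hs => (hd s hs).deriv) (mem_Ioi.2 hr) (mem_Ioi.2 one_pos)
  refine ⟨(q 1 - k) / 1, fun r hr => ?_⟩
  have := hconst r hr
  rw [div_eq_iff hr.ne'] at this
  linarith

theorem hasDerivAt_massFun_massless (L e : ℝ) :
    (∀ r, 0 < r → HasDerivAt (massFun L 0 fun _ => e) (4 * L * r ^ 3 / 3) r) ∧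
      ∀ r : ℝ, 0 < r → HasDerivAt (fun r => 4 * L * r ^ 3 / 3) (4 * L * r ^ 2) r := by
  refine ⟨fun r _ => ?_, fun r _ =>
    (((hasDerivAt_pow 3 r).const_mul (4 * L)).div_const 3).congr_deriv (by simp; ring)⟩
  have : HasDerivAt (fun r : ℝ => -e ^ 2 + L * r ^ 4 / 3) (4 * L * r ^ 3 / 3) r :=
    ((((hasDerivAt_pow 4 r).const_mul L).div_const 3).const_add (-e ^ 2)).congr_deriv (by
      simp; ring)
  exact this.congr_of_eventuallyEq (Eventually.of_forall fun s => by simp [massFun])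

namespace IsKerrNewmanForm

variable {F : BlackHoleFamily} {a L : ℝ} (hF : IsKerrNewmanForm F a L) {e : ℝ}
include hF

theorem exists_loss_of_radiation {M : ℝ} {ε : ℝ → ℝ} (h : IsElectricalRadiation F e M ε) :
    ∃ m : ℝ, 0 < m ∧ ∀ r, 0 < r → ε r ^ 2 = 2 * r * m + e ^ 2 := by
  obtain ⟨q₁, q₂, hq, hq₁⟩ := exists_hasDerivAt_sq h.smooth
  have hfield := (hF.field_iff hq hq₁).1 h.field
  obtain ⟨b, hb⟩ := exists_sq_eq_of_sub_mul_deriv hq fun r hr => (hfield r hr).2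
  -- If b < 0, then br + e² = -1 at r = (e² + 1)/(-b), but it is a square.
  have hb0 : 0 ≤ b := by
    by_contra! hneg
    have hr : 0 < (e ^ 2 + 1) / (-b) := by
      have : 0 < -b := by linarith
      positivity
    have h1 := hb _ hr
    have h2 : b * ((e ^ 2 + 1) / (-b)) = -(e ^ 2 + 1) := by
      have := hneg.ne
      field_simp
    nlinarith [sq_nonneg (ε ((e ^ 2 + 1) / (-b)))]
  -- If b = 0, then ε² = e², and by continuity on the connected half-line ε is constantly e or
  -- constantly -e. The choice of sign needs e ≠ 0; for e = 0, ε vanishes.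
  have hbne : b ≠ 0 := by
    rintro rfl
    refine h.variable_charge ?_
    have hsq : EqOn (ε ^ 2) ((fun _ => e) ^ 2) (Ioi 0) := fun r hr => by
      have := hb r hr
      simp only [Pi.pow_apply]
      linarith
    by_cases he : e = 0
    · refine ⟨0, fun r hr => ?_⟩
      have := hsq (mem_Ioi.2 hr)
      simpa [he] using this
    rcases (convex_Ioi (0 : ℝ)).isPreconnected.eq_or_eq_neg_of_sq_eq h.smooth.continuousOn
      continuousOn_const hsq (fun _ => he) with h' | h'
    · exact ⟨e, fun r hr => h' (mem_Ioi.2 hr)⟩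
    · exact ⟨-e, fun r hr => h' (mem_Ioi.2 hr)⟩
  refine ⟨b / 2, by positivity, fun r hr => ?_⟩
  rw [hb r hr]
  ring

theorem metric_radiated {M m : ℝ} {ε : ℝ → ℝ}
    (hε : ∀ r, 0 < r → ε r ^ 2 = 2 * r * m + e ^ 2) {x : Pt} (hx : x ∈ chart) :
    F.metric M ε x = F.metric (M - m) (fun _ => e) x := by
  rw [hF.metric_eq_iff hx, massFun, massFun, hε _ hx.1]
  ring

theorem field_of_sq_eq {M m : ℝ} {ε : ℝ → ℝ} (hε : ∀ r, 0 < r → ε r ^ 2 = 2 * r * m + e ^ 2) :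
    HasElectromagneticField F e M ε := by
  have hq : ∀ r, 0 < r → HasDerivAt (fun r => ε r ^ 2) (2 * m) r := by
    intro r hr
    have h1 : HasDerivAt (fun r => 2 * r * m + e ^ 2) (2 * m) r :=
      ((((hasDerivAt_id r).const_mul 2).mul_const m).add_const (e ^ 2)).congr_deriv (by ring)
    refine h1.congr_of_eventuallyEq ?_
    filter_upwards [Ioi_mem_nhds hr] with s hs using hε s hs
  refine (hF.field_iff (q₂ := fun _ => 0) hq fun r _ => hasDerivAt_const _ _).2 fun r hr =>
    ⟨rfl, ?_⟩
  rw [hε r hr]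
  ring

theorem exists_evaporation (he : e ≠ 0) (M : ℝ) {m : ℕ → ℝ} (hm : ∀ k, 0 < m k) :
    ∃ ε : ℕ → ℝ → ℝ, IsEvaporation F e M (fun k => M - ∑ i ∈ Finset.range k, m i) ε := by
  have hpos : ∀ k r, 0 < r → 0 < 2 * r * m k + e ^ 2 := fun k r hr => by
    have := hm k
    positivity
  have hsq : ∀ k r, 0 < r → √(2 * r * m k + e ^ 2) ^ 2 = 2 * r * m k + e ^ 2 := fun k r hr =>
    Real.sq_sqrt (hpos k r hr).le
  -- The radicand is positive for r > 0, so the root is smooth there; equal values at r = 1 and r =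
  -- 2 would force m k = 0.
  refine ⟨fun k r => √(2 * r * m k + e ^ 2), by simp, fun k => ⟨?_, ?_, hF.field_of_sq_eq (hsq k)⟩,
    fun k x hx => ?_⟩
  · refine ContDiffOn.sqrt ?_ fun r hr => (hpos k r hr).ne'
    fun_prop
  · rintro ⟨c, hc⟩
    have h1 := hsq k 1 one_pos
    have h2 := hsq k 2 two_pos
    rw [hc 1 one_pos] at h1
    rw [hc 2 two_pos] at h2
    have := hm k
    linarith
  · rw [hF.metric_radiated (hsq k) hx, Finset.sum_range_succ, sub_sub]

/-- The masses are tied together only by equality of metrics; comparing H at the single radius r = 1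
already fixes the next mass. -/
theorem exists_losses_of_evaporation {M : ℝ} {mass : ℕ → ℝ} {ε : ℕ → ℝ → ℝ}
    (h : IsEvaporation F e M mass ε) :
    ∃ m : ℕ → ℝ, (∀ k, 0 < m k) ∧ (∀ k r, 0 < r → ε k r ^ 2 = 2 * r * m k + e ^ 2) ∧
      ∀ n, mass n = M - ∑ i ∈ Finset.range n, m i := by
  choose m hm hε using fun k => hF.exists_loss_of_radiation (h.radiates k)
  refine ⟨m, hm, hε, fun n => ?_⟩
  induction n with
  | zero => simp [h.init]
  | succ n ih =>
    let x : Pt := ![0, 1, Real.pi / 2, 0]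
    have hx : x ∈ chart :=
      ⟨one_pos, by simp [x]; positivity, by simp [x]; linarith [Real.pi_pos]⟩
    have h1 := h.leaves n x hx
    rw [hF.metric_radiated (hε n) hx, hF.metric_eq_iff hx, massFun, massFun] at h1
    have hx1 : x 1 = 1 := rfl
    rw [hx1] at h1
    rw [Finset.sum_range_succ]
    linarith

/-! ### The massless charged spacetime -/

/-- For m = μ(R²p + iq) the cross terms cancel in m m̄ + m̄ m, leaving 2|μ|²(R⁴pp + qq) = R²pp +
qq/R². -/
theorem isNullTetradOf {M : ℝ} {ε : ℝ → ℝ} {g : MetricField}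
    (hg : EqOn g (F.metric M ε) chart) : (F.tetrad M ε).IsNullTetradOf g := by
  intro x hx b c
  have hT := hF.isAdaptedAt M ε hx
  have hμ := hT.norm
  have h0 : (Rsq a x : ℂ) ≠ 0 := Complex.ofReal_ne_zero.2 (Rsq_pos a hx).ne'
  rw [hg hx, hF.metric M ε hx, kerrSchild_eq_frameForm a _ hx, hT.l_eq, hT.n_eq, hT.m_eq,
    frameForm]
  have hI := Complex.I_sq
  simp only [star_add, star_mul', Complex.star_def, Complex.conj_ofReal, Complex.conj_I] at hμ ⊢
  push_cast
  rw [eq_div_iff (by simpa using h0)] at hμ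
  field_simp
  linear_combination (Rsq a x ^ 2 * (frameP b * frameP c : ℂ)
      + frameQ a (x 1) (Real.sin (x 2)) b * frameQ a (x 1) (Real.sin (x 2)) c) * hμ
    - 2 * Rsq a x * frameCoeff a x * (starRingEnd ℂ) (frameCoeff a x)
      * (frameQ a (x 1) (Real.sin (x 2)) b * frameQ a (x 1) (Real.sin (x 2)) c) * hI

/-- With ρ = |R|², the prefactor is (r + ia cos θ)²/ρ³. The real part of ψ₂ (from D and the trace)
and the imaginary part (from E) are those of this prefactor times one common real factor. -/
theorem npPsi2_massless {g : MetricField} (hg : EqOn g (F.metric 0 fun _ => e) chart) {x : Pt}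
    (hx : x ∈ chart) :
    npPsi2 g (F.tetrad 0 fun _ => e) x = 1 / (star (Rc a x) * star (Rc a x) * (Rsq a x : ℂ))
            * ((e ^ 2 + L * (x 1) ^ 2 / 3 * a ^ 2 * Real.cos (x 2) ^ 2 : ℝ) : ℂ) := by
  obtain ⟨hH, hH₁⟩ := hasDerivAt_massFun_massless L e
  have hgks : EqOn g (kerrSchild a (massFun L 0 fun _ => e)) chart := fun y hy => by
    rw [hg hy, hF.metric _ _ hy]
  rw [(isTypeDAt_kerrSchild hgks hH hH₁ hx).npPsi2_eq (hF.isAdaptedAt 0 _ hx)]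
  have h0 := (Rsq_pos a hx).ne'
  have hR : Rc a x ≠ 0 := Rc_ne_zero a hx
  have hinv : 1 / (star (Rc a x) * star (Rc a x) * (Rsq a x : ℂ)) = Rc a x ^ 2 / Rsq a x ^ 3 := by
    have hs : star (Rc a x) ≠ 0 := star_ne_zero.2 hR
    rw [← Rc_mul_star]
    field_simp
  have hR2 : Rc a x ^ 2 = ((x 1 ^ 2 - a ^ 2 * Real.cos (x 2) ^ 2 : ℝ) : ℂ)
      + Complex.I * ((2 * x 1 * a * Real.cos (x 2) : ℝ) : ℂ) := by
    have hI := Complex.I_sq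
    simp only [Rc]
    push_cast
    linear_combination ((a : ℂ) ^ 2 * Complex.cos (x 2) ^ 2) * hI
  have hρ : Rsq a x = x 1 ^ 2 + a ^ 2 * Real.cos (x 2) ^ 2 := rfl
  have hre : curvD a (x 1) (Real.cos (x 2)) (Rsq a x) (massFun L 0 (fun _ => e) (x 1))
        (4 * L * x 1 ^ 3 / 3)
      - (curvA a (x 1) (Real.cos (x 2)) (Rsq a x) (massFun L 0 (fun _ => e) (x 1))
          (4 * L * x 1 ^ 3 / 3) (4 * L * x 1 ^ 2)
        + 4 * curvD a (x 1) (Real.cos (x 2)) (Rsq a x) (massFun L 0 (fun _ => e) (x 1))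
          (4 * L * x 1 ^ 3 / 3)
        - curvB a (x 1) (Real.cos (x 2)) (Rsq a x) (massFun L 0 (fun _ => e) (x 1))) / 6
      = (x 1 ^ 2 - a ^ 2 * Real.cos (x 2) ^ 2) / Rsq a x ^ 3
        * (e ^ 2 + L * x 1 ^ 2 / 3 * a ^ 2 * Real.cos (x 2) ^ 2) := by
    simp only [curvA, curvB, curvD, massFun]
    generalize Rsq a x = ρ at *
    field_simp
    rw [hρ]
    ring
  have him : curvE a (x 1) (Real.cos (x 2)) (Rsq a x) (massFun L 0 (fun _ => e) (x 1))
        (4 * L * x 1 ^ 3 / 3)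
      = 2 * x 1 * a * Real.cos (x 2) / Rsq a x ^ 3
        * (e ^ 2 + L * x 1 ^ 2 / 3 * a ^ 2 * Real.cos (x 2) ^ 2) := by
    simp only [curvE, massFun]
    generalize Rsq a x = ρ at *
    field_simp
    rw [hρ]
    ring
  rw [hinv, hR2, him]
  have hre' := congrArg (Complex.ofReal) hre
  push_cast at hre' ⊢
  linear_combination hre'

end IsKerrNewmanForm

/-- The outgoing principal null ray `u = 0`, `r = s`, `θ = π / 2`, `φ = 0`. -/
noncomputable def equatorialRay (s : ℝ) : Pt := ![0, s, Real.pi / 2, 0]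

theorem equatorialRay_mem_chart {s : ℝ} (hs : 0 < s) : equatorialRay s ∈ chart :=
  ⟨hs, by simp [equatorialRay]; positivity, by simp [equatorialRay]; linarith [Real.pi_pos]⟩

theorem hasDerivAt_equatorialRay (s : ℝ) : HasDerivAt equatorialRay ![0, 1, 0, 0] s := by
  refine hasDerivAt_pi.2 fun i => ?_
  fin_cases i
  exacts [hasDerivAt_const _ _, hasDerivAt_id _, hasDerivAt_const _ _, hasDerivAt_const _ _]

/-- The r column of the metric depends only on θ and g_{rr} = 0, so ∂_r is null and all Γ_{d,rr}
vanish, whatever H is. Thus r is an affine parameter. -/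
theorem isFutureNullGeodesic_equatorialRay {a : ℝ} {g : MetricField} {H H₁ H₂ : ℝ → ℝ}
    (hg : EqOn g (kerrSchild a H) chart)
    (hH : ∀ r, 0 < r → HasDerivAt H (H₁ r) r) (hH₁ : ∀ r, 0 < r → HasDerivAt H₁ (H₂ r) r)
    {τ : Pt → Fin 4 → ℝ} (hτ : ∀ x ∈ chart, τ x 1 = 1) :
    IsFutureNullGeodesic g τ equatorialRay := by
  have hderiv : deriv equatorialRay = fun _ => ![0, 1, 0, 0] :=
    funext fun s => (hasDerivAt_equatorialRay s).deriv
  refine ⟨?_, fun s hs => equatorialRay_mem_chart hs, fun s hs => ?_, fun s hs => ?_,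
    fun s hs b => ?_⟩
  · refine contDiffOn_pi.2 fun i => ?_
    fin_cases i
    exacts [contDiffOn_const, contDiffOn_id, contDiffOn_const, contDiffOn_const]
  · rw [hg (equatorialRay_mem_chart hs), hderiv]
    simp [Fin.sum_univ_four, kerrSchild, ksMatrix]
  · rw [hderiv]
    simp [Fin.sum_univ_four, hτ _ (equatorialRay_mem_chart hs)]
  · have hx := equatorialRay_mem_chart hs
    have hΓ : christoffel g b 1 1 (equatorialRay s) = 0 := by
      rw [christoffel_congr hg _ _ _ hx, (hasMetricJet_kerrSchild hH hH₁ a).christoffel_eq hx]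
      refine Finset.sum_eq_zero fun d _ => mul_eq_zero_of_right _ ?_
      fin_cases d <;> simp [lowerChristoffel, ksJet, ksMatrix, ksCoeffJet]
    rw [hderiv]
    simp [Fin.sum_univ_four, hΓ]

theorem isNakedSingularity_massless {a L e : ℝ} (he : e ≠ 0) {g : MetricField}
    (hg : EqOn g (kerrSchild a (massFun L 0 fun _ => e)) chart)
    {τ : Pt → Fin 4 → ℝ} (hτ : ∀ x ∈ chart, τ x 1 = 1) : IsNakedSingularity g τ := by
  obtain ⟨hH, hH₁⟩ := hasDerivAt_massFun_massless L e
  -- Since g^{rr} = -Δ*/R², its sign does not depend on θ, and one equatorial point decides.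
  have hradii : ∀ r, r ∈ timelikeRadii g ↔ 0 < r ∧ 0 < r ^ 2 + a ^ 2 + e ^ 2 - L * r ^ 4 / 3 := by
    have hinv : ∀ x ∈ chart, (g x)⁻¹ 1 1 < 0 ↔
        0 < x 1 ^ 2 + a ^ 2 + e ^ 2 - L * x 1 ^ 4 / 3 := by
      intro x hx
      rw [hg hx, kerrSchild_inv a _ hx]
      have : ksInv a (x 1) (Real.sin (x 2)) (Rsq a x) (massFun L 0 (fun _ => e) (x 1)) 1 1
          = -((x 1 ^ 2 + a ^ 2 + e ^ 2 - L * x 1 ^ 4 / 3) / Rsq a x) := by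
        simp only [ksInv, massFun, Matrix.of_apply, Matrix.cons_val_one, Matrix.cons_val_zero]
        ring
      rw [this, neg_lt_zero, div_pos_iff_of_pos_right (Rsq_pos a hx)]
    refine fun r => ⟨fun h => ⟨h.1, ?_⟩, fun h => ⟨h.1, fun x hx hr => (hinv x hx).2 (hr ▸ h.2)⟩⟩
    exact (hinv _ (equatorialRay_mem_chart h.1)).1
      (h.2 (equatorialRay r) (equatorialRay_mem_chart h.1) rfl)
  refine ⟨⟨equatorialRay, isFutureNullGeodesic_equatorialRay hg hH hH₁ hτ, ?_, ?_, tendsto_id⟩,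
    ?_, ?_⟩
  · exact tendsto_id.mono_left nhdsWithin_le_nhds
  -- On this ray R² = r² and the scalar curvature stays at 4Λ*, so the Ricci square is the invariant
  -- to use. The equator matters: if a cos θ ≠ 0, then R² does not tend to 0.
  · refine Or.inr (Or.inl ?_)
    have hsq : ∀ s, 0 < s → |ricciSq g (equatorialRay s)| = 4 * L ^ 2 + 4 * e ^ 4 * s⁻¹ ^ 8 := by
      intro s hs
      have hx := equatorialRay_mem_chart hs
      have hρ : Rsq a (equatorialRay s) = s ^ 2 := by simp [Rsq, equatorialRay]
      have h1 : equatorialRay s 1 = s := rfl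
      have h2 : Real.cos (equatorialRay s 2) = 0 := by simp [equatorialRay]
      rw [(isTypeDAt_kerrSchild hg hH hH₁ hx).ricciSq_eq, hρ, h1, h2, abs_of_nonneg (by positivity)]
      simp only [curvA, curvB, curvD, massFun]
      field_simp
      ring
    have hlim : Tendsto (fun s : ℝ => 4 * L ^ 2 + 4 * e ^ 4 * s⁻¹ ^ 8) (𝓝[>] 0) atTop :=
      tendsto_atTop_add_const_left _ _ (Tendsto.const_mul_atTop (by positivity)
        ((tendsto_pow_atTop (by norm_num)).comp tendsto_inv_nhdsGT_zero))
    refine hlim.congr' ?_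
    filter_upwards [self_mem_nhdsWithin] with s hs using (hsq s hs).symm
  -- This radius satisfies r ≤ 1 and |L| r ≤ 1, so L r⁴ ≤ r³ ≤ r² and Δ* > 0.
  · refine ⟨1 / (1 + |L|), (hradii _).2 ?_⟩
    have hL := abs_nonneg L
    have hr : 0 < 1 / (1 + |L|) := by positivity
    have hLr : |L| * (1 / (1 + |L|)) ≤ 1 := by
      rw [mul_one_div, div_le_one (by positivity)]
      linarith
    have hr1 : 1 / (1 + |L|) ≤ 1 := by
      rw [div_le_one (by positivity)]
      linarith
    generalize 1 / (1 + |L|) = r at *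
    refine ⟨hr, ?_⟩
    have h1 : L * r ^ 4 ≤ r ^ 3 := by
      calc L * r ^ 4 ≤ |L| * r ^ 4 := by gcongr; exact le_abs_self L
        _ = |L| * r * r ^ 3 := by ring
        _ ≤ 1 * r ^ 3 := by gcongr
        _ = r ^ 3 := one_mul _
    have h2 : r ^ 3 ≤ r ^ 2 := pow_le_pow_of_le_one hr.le hr1 (by norm_num)
    have h3 : 0 < e ^ 2 := by positivity
    nlinarith [sq_nonneg a, sq_nonneg r]
  · intro r hr r' hr' hlt
    obtain ⟨hr0, hr1⟩ := (hradii r).1 hr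
    refine (hradii r').2 ⟨hr', ?_⟩
    have he2 : 0 < e ^ 2 := by positivity
    -- Scaling by t < 1 multiplies the cosmological term by exactly t⁴ and the nonnegative terms by
    -- t² or 1, which are at least t⁴. Positivity of Δ* therefore passes to smaller radii.
    obtain ⟨t, rfl⟩ : ∃ t, r' = t * r := ⟨r' / r, by field_simp⟩
    have ht0 : 0 < t := pos_of_mul_pos_left hr' hr0.le
    have ht1 : t < 1 := by
      by_contra! h
      nlinarith
    have ht2 : t ^ 4 ≤ t ^ 2 := pow_le_pow_of_le_one ht0.le ht1.le (by norm_num)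
    have ht4 : t ^ 4 ≤ 1 := pow_le_one₀ ht0.le ht1.le
    have h1 : 0 < t ^ 4 * (r ^ 2 + a ^ 2 + e ^ 2 - L * r ^ 4 / 3) := by positivity
    have h2 : t ^ 4 * r ^ 2 ≤ t ^ 2 * r ^ 2 := by gcongr
    have h3 : t ^ 4 * (a ^ 2 + e ^ 2) ≤ 1 * (a ^ 2 + e ^ 2) := by gcongr
    have h4 : (t * r) ^ 4 = t ^ 4 * r ^ 4 := by ring
    rw [h4, mul_pow]
    linarith

theorem IsKerrNewmanForm.isInstantaneousNakedSingularity {F : BlackHoleFamily} {a L : ℝ}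
    (hF : IsKerrNewmanForm F a L) {e : ℝ} (he : e ≠ 0) {g : MetricField}
    (hg : EqOn g (F.metric 0 fun _ => e) chart) {M : ℝ} {mass m : ℕ → ℝ} (hm : ∀ k, 0 < m k)
    (hmass : ∀ n, mass n = M - ∑ i ∈ Finset.range n, m i) {n : ℕ}
    (hn : ∑ i ∈ Finset.range n, m i = M) :
    IsInstantaneousNakedSingularity g (F.tetrad 0 fun _ => e).time mass n := by
  -- The total loss increases strictly, so it equals M at one stage only, is smaller before and
  -- larger after.
  have hmono : StrictMono fun n => ∑ i ∈ Finset.range n, m i :=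
    strictMono_nat_of_lt_succ fun n => by
      rw [Finset.sum_range_succ]
      linarith [hm n]
  refine ⟨isNakedSingularity_massless he (fun y hy => by rw [hg hy, hF.metric _ _ hy]) ?_, ?_, ?_,
    ?_⟩
  · intro x hx
    simp [NullTetrad.time, hF.l_eq _ _ x hx, hF.n_eq _ _ x hx, frameL, frameN]
  · rw [hmass, hn, sub_self]
  · intro k hk
    rw [hmass, ← hn]
    exact sub_pos.2 (hmono hk)
  · intro k hk
    rw [hmass, ← hn]
    exact sub_neg.2 (hmono hk)

/-! ### The two families -/

theorem isKerrNewmanForm_knDeSitter (a L : ℝ) : IsKerrNewmanForm (knDeSitter a L) a L where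
  metric M ε x hx := by
    have h0 := (Rsq_pos a hx).ne'
    have hρ : Rsq a x = x 1 ^ 2 + a ^ 2 - a ^ 2 * Real.sin (x 2) ^ 2 := by
      rw [Rsq, Real.cos_sq']; ring
    simp only [knDeSitter, kerrSchild, deltaStar]
    generalize Rsq a x = ρ at *
    ext i j
    fin_cases i <;> fin_cases j <;> simp [ksMatrix, ksCoeff, massFun]
    · ring
    · ring
    · field_simp
      rw [hρ]
      ring
  l_eq M ε x hx := by simp [knDeSitter, frameL]
  n_eq M ε x hx := by
    have h : deltaStar a L M ε (x 1) = x 1 ^ 2 + a ^ 2 - massFun L M ε (x 1) := by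
      simp only [deltaStar, massFun]
      ring
    simp [knDeSitter, frameN, h]
  m_eq M ε x hx := by
    funext i
    fin_cases i <;> simp [knDeSitter, frameCoeff, frameP, frameQ] <;> ring
  lambdaC x hx := rfl
  phi11C x hx := rfl
  maxwell e x hx := rfl

theorem Rsq_zero (x : Pt) : Rsq 0 x = x 1 ^ 2 := by simp [Rsq]

theorem Rc_zero (x : Pt) : Rc 0 x = x 1 := by simp [Rc]

/-- At a = 0 one has R = r, and H/r² produces the separate fractions of `rnFun` once r ≠ 0. -/
theorem isKerrNewmanForm_rnDeSitter (L : ℝ) : IsKerrNewmanForm (rnDeSitter L) 0 L where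
  metric M ε x hx := by
    have h0 := hx.1.ne'
    simp only [rnDeSitter, kerrSchild, Rsq_zero]
    ext i j
    fin_cases i <;> fin_cases j <;> simp [ksMatrix, ksCoeff, massFun, rnFun]
    field_simp
    ring
  l_eq M ε x hx := by simp [rnDeSitter, frameL]
  n_eq M ε x hx := by
    have h0 := hx.1.ne'
    have h : rnFun L M ε (x 1) / 2 = (x 1 ^ 2 - massFun L M ε (x 1)) / (2 * x 1 ^ 2) := by
      simp only [rnFun, massFun]
      field_simp
      ring
    simp [rnDeSitter, frameN, h, Rsq_zero]
  m_eq M ε x hx := by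
    have h0 : (x 1 : ℂ) ≠ 0 := Complex.ofReal_ne_zero.2 hx.1.ne'
    have h2 : ((√2 : ℝ) : ℂ) ≠ 0 := Complex.ofReal_ne_zero.2 (by positivity)
    funext i
    fin_cases i <;> simp [rnDeSitter, frameCoeff, frameP, frameQ, Rsq_zero, Rc_zero] <;> field_simp
  lambdaC x hx := by
    have h0 := hx.1.ne'
    simp only [rnDeSitter, knDeSitter, Rsq_zero]
    field_simp
  phi11C x hx := by simp [rnDeSitter, knDeSitter]
  maxwell e x hx := by simp [rnDeSitter, knDeSitter, Rc_zero]

theorem chargedDeSitter_eq (L e : ℝ) :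
    chargedDeSitter L e = (rnDeSitter L).metric 0 fun _ => e := by
  funext x
  simp [chargedDeSitter, rnDeSitter, rnFun]

theorem rotatingChargedDeSitter_eq (a L e : ℝ) :
    rotatingChargedDeSitter a L e = (knDeSitter a L).metric 0 fun _ => e := by
  funext x
  ext i j
  fin_cases i <;> fin_cases j <;>
    simp [rotatingChargedDeSitter, knDeSitter, deltaStar] <;> (try left) <;> ring

/-- The evaporation theorem for a family of Kerr–Newman form. -/
theorem IsKerrNewmanForm.evaporation {F : BlackHoleFamily} {a L : ℝ} (hF : IsKerrNewmanForm F a L)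
    {e : ℝ} (he : e ≠ 0) :
    (∀ (M : ℝ) (ε : ℝ → ℝ), IsElectricalRadiation F e M ε →
        ∃ m : ℝ, 0 < m ∧ (∀ r, 0 < r → ε r ^ 2 = 2 * r * m + e ^ 2) ∧
          ∀ x ∈ chart, F.metric M ε x = F.metric (M - m) (fun _ => e) x) ∧
      (∀ (M : ℝ) (m : ℕ → ℝ), (∀ k, 0 < m k) →
        ∃ ε : ℕ → ℝ → ℝ, IsEvaporation F e M (fun k => M - ∑ i ∈ Finset.range k, m i) ε) ∧
      (∀ (M : ℝ) (mass : ℕ → ℝ) (ε : ℕ → ℝ → ℝ), IsEvaporation F e M mass ε →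
        ∃ m : ℕ → ℝ, (∀ k, 0 < m k) ∧
          (∀ k r, 0 < r → ε k r ^ 2 = 2 * r * m k + e ^ 2) ∧
          (∀ n, mass n = M - ∑ i ∈ Finset.range n, m i) ∧
          ∀ n, ∑ i ∈ Finset.range n, m i = M →
            (∀ x ∈ chart, F.metric (mass n) (fun _ => e) x = F.metric 0 (fun _ => e) x) ∧
            IsInstantaneousNakedSingularity (F.metric 0 fun _ => e)
              (F.tetrad 0 fun _ => e).time mass n) ∧
      (F.tetrad 0 fun _ => e).IsNullTetradOf (F.metric 0 fun _ => e) ∧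
      (∀ x ∈ chart, npPsi2 (F.metric 0 fun _ => e) (F.tetrad 0 fun _ => e) x
          = 1 / (star (Rc a x) * star (Rc a x) * (Rsq a x : ℂ))
            * ((e ^ 2 + L * (x 1) ^ 2 / 3 * a ^ 2 * Real.cos (x 2) ^ 2 : ℝ) : ℂ)) ∧
      HasElectromagneticField F e 0 (fun _ => e) := by
  refine ⟨fun M ε h => ?_, fun M m hm => hF.exists_evaporation he M hm, fun M mass ε h => ?_,
    hF.isNullTetradOf (eqOn_refl _ _), fun x hx => hF.npPsi2_massless (eqOn_refl _ _) hx,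
    hF.field_of_sq_eq (m := 0) fun r _ => by ring⟩
  · obtain ⟨m, hm, hε⟩ := hF.exists_loss_of_radiation h
    exact ⟨m, hm, hε, fun x hx => hF.metric_radiated hε hx⟩
  · obtain ⟨m, hm, hε, hmass⟩ := hF.exists_losses_of_evaporation h
    refine ⟨m, hm, hε, hmass, fun n hn => ⟨fun x _ => ?_,
      hF.isInstantaneousNakedSingularity he (eqOn_refl _ _) hm hmass hn⟩⟩
    rw [hmass, hn, sub_self]

theorem theorem2 (L e : ℝ) (he : e ≠ 0) :
    -- The non-rotating case.
    ((∀ (M : ℝ) (ε : ℝ → ℝ), IsElectricalRadiation (rnDeSitter L) e M ε →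
        ∃ m : ℝ, 0 < m ∧ (∀ r, 0 < r → ε r ^ 2 = 2 * r * m + e ^ 2) ∧
          ∀ x ∈ chart, (rnDeSitter L).metric M ε x
            = (rnDeSitter L).metric (M - m) (fun _ => e) x) ∧
      (∀ (M : ℝ) (m : ℕ → ℝ), (∀ k, 0 < m k) →
        ∃ ε : ℕ → ℝ → ℝ, IsEvaporation (rnDeSitter L) e M
          (fun k => M - ∑ i ∈ Finset.range k, m i) ε) ∧
      (∀ (M : ℝ) (mass : ℕ → ℝ) (ε : ℕ → ℝ → ℝ), IsEvaporation (rnDeSitter L) e M mass ε →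
        ∃ m : ℕ → ℝ, (∀ k, 0 < m k) ∧
          (∀ k r, 0 < r → ε k r ^ 2 = 2 * r * m k + e ^ 2) ∧
          (∀ n, mass n = M - ∑ i ∈ Finset.range n, m i) ∧
          ∀ n, ∑ i ∈ Finset.range n, m i = M →
            (∀ x ∈ chart, (rnDeSitter L).metric (mass n) (fun _ => e) x
              = chargedDeSitter L e x) ∧
            IsInstantaneousNakedSingularity (chargedDeSitter L e)
              ((rnDeSitter L).tetrad 0 (fun _ => e)).time mass n) ∧
      ((rnDeSitter L).tetrad 0 (fun _ => e)).IsNullTetradOf (chargedDeSitter L e) ∧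
      (∀ x ∈ chart, npPsi2 (chargedDeSitter L e) ((rnDeSitter L).tetrad 0 (fun _ => e)) x
        = ((e ^ 2 / (x 1) ^ 4 : ℝ) : ℂ)) ∧
      HasElectromagneticField (rnDeSitter L) e 0 (fun _ => e)) ∧
    -- The rotating case.
    (∀ a : ℝ,
      (∀ (M : ℝ) (ε : ℝ → ℝ), IsElectricalRadiation (knDeSitter a L) e M ε →
        ∃ m : ℝ, 0 < m ∧ (∀ r, 0 < r → ε r ^ 2 = 2 * r * m + e ^ 2) ∧
          ∀ x ∈ chart, (knDeSitter a L).metric M ε x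
            = (knDeSitter a L).metric (M - m) (fun _ => e) x) ∧
      (∀ (M : ℝ) (m : ℕ → ℝ), (∀ k, 0 < m k) →
        ∃ ε : ℕ → ℝ → ℝ, IsEvaporation (knDeSitter a L) e M
          (fun k => M - ∑ i ∈ Finset.range k, m i) ε) ∧
      (∀ (M : ℝ) (mass : ℕ → ℝ) (ε : ℕ → ℝ → ℝ), IsEvaporation (knDeSitter a L) e M mass ε →
        ∃ m : ℕ → ℝ, (∀ k, 0 < m k) ∧
          (∀ k r, 0 < r → ε k r ^ 2 = 2 * r * m k + e ^ 2) ∧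
          (∀ n, mass n = M - ∑ i ∈ Finset.range n, m i) ∧
          ∀ n, ∑ i ∈ Finset.range n, m i = M →
            (∀ x ∈ chart, (knDeSitter a L).metric (mass n) (fun _ => e) x
              = rotatingChargedDeSitter a L e x) ∧
            IsInstantaneousNakedSingularity (rotatingChargedDeSitter a L e)
              ((knDeSitter a L).tetrad 0 (fun _ => e)).time mass n) ∧
      ((knDeSitter a L).tetrad 0 (fun _ => e)).IsNullTetradOf (rotatingChargedDeSitter a L e) ∧
      (∀ x ∈ chart,
        npPsi2 (rotatingChargedDeSitter a L e) ((knDeSitter a L).tetrad 0 (fun _ => e)) x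
          = 1 / (star (Rc a x) * star (Rc a x) * (Rsq a x : ℂ))
            * ((e ^ 2 + L * (x 1) ^ 2 / 3 * a ^ 2 * Real.cos (x 2) ^ 2 : ℝ) : ℂ)) ∧
      HasElectromagneticField (knDeSitter a L) e 0 (fun _ => e)) := by
  refine ⟨?_, fun a => ?_⟩
  · obtain ⟨h1, h2, h3, h4, h5, h6⟩ := (isKerrNewmanForm_rnDeSitter L).evaporation he
    rw [← chargedDeSitter_eq] at h3 h4 h5
    refine ⟨h1, h2, h3, h4, fun x hx => ?_, h6⟩
    rw [h5 x hx, Rc_zero, Rsq_zero]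
    simp
    ring
  · rw [rotatingChargedDeSitter_eq]
    exact (isKerrNewmanForm_knDeSitter a L).evaporation he
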